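/- A rooted map is a connected multigraph (loops and multiple edges allowed) together with a cyclic ordering of the half-edges around each vertex and a distinguished corner (a corner being a pair of consecutive half-edges around a vertex; the map consisting of one isolated vertex has exactly one corner). Rooted maps are considered up to isomorphism, and their genus is not restricted. For $n\ge 0$ let $X_n$ denote the number of vertices of a rooted map chosen uniformly at random among the rooted maps with $n$ edges. Theorem. As $n\to\infty$, $$\frac{X_n-\mathbb{E}(X_n)}{\sqrt{\operatorname{Var}(X_n)}}\overset{d}{\longrightarrow}\mathcal N(0,1),\qquad \mathbb{E}(X_n)\sim\log n,\qquad \operatorname{Var}(X_n)\sim\log n .$$ Moreover, $$\mathbb{E}\bigl(v^{X_n}\bigr)=\frac{2^{v-1}}{\Gamma(v)}\,n^{v-1}\bigl(1+O(n^{-1})\bigr),$$ uniformly for $v$ in compact subsets of $\mathbb{C}\setminus\{0,-1,-2,\dots\}$: for every such compact set $K$ there is a constant $C$ such that, for all $n\ge1$ and all $v\in K$, $$\left|\mathbb{E}\bigl(v^{X_n}\bigr)-\frac{2^{v-1}}{\Gamma(v)}n^{v-1}\right|\le \frac{C}{n}\left|\frac{2^{v-1}}{\Gamma(v)}n^{v-1}\right|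 .$$ -/

import Mathlib

open MeasureTheory ProbabilityTheory Filter
open scoped Topology Asymptotics

/-- A rooted combinatorial map (connected, no restriction on the genus) with `n` edges whose `2n`
half-edges are labelled by `Fin (2 * n)`.  The cycles of `next` are the cyclic orderings of the
half-edges around the vertices, and `opp` exchanges the two halves of every edge.
The corners are in bijection with the half-edges (the corner preceding a half-edge), except for the
map consisting of an isolated vertex (`n = 0`), which has no half-edge and exactly one corner,
written `none`. -/
structure LabelledMap (n : ℕ) where
  next : Equiv.Perm (Fin (2 * n))
  opp : Equiv.Perm (Fin (2 * n))
  opp_opp : ∀ h, opp (opp h) = h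
  opp_ne : ∀ h, opp h ≠ h
  connected : MulAction.IsPretransitive (Subgroup.closure {next, opp}) (Fin (2 * n))
  root : Option (Fin (2 * n))
  root_eq_none_iff : root = none ↔ n = 0

namespace LabelledMap

/-- The number of vertices: the number of cycles of `next` (fixed points included), or `1` for the
map consisting of an isolated vertex. -/
noncomputable def numVertices {n : ℕ} (m : LabelledMap n) : ℕ :=
  if n = 0 then 1 else Nat.card (Quotient (Equiv.Perm.SameCycle.setoid m.next))

/-- `e` is an isomorphism of rooted maps. -/
def IsIso {n : ℕ} (m m' : LabelledMap n) (e : Equiv.Perm (Fin (2 * n))) : Prop :=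
  (∀ h, e (m.next h) = m'.next (e h)) ∧ (∀ h, e (m.opp h) = m'.opp (e h)) ∧
    m.root.map e = m'.root

/-- Two labelled rooted maps are equivalent if they are isomorphic. -/
instance setoid (n : ℕ) : Setoid (LabelledMap n) where
  r m m' := ∃ e, IsIso m m' e
  iseqv :=
    { refl := fun m => ⟨1, by simp [IsIso]⟩
      symm := by
        rintro m m' ⟨e, h1, h2, h3⟩
        refine ⟨e.symm, fun h => ?_, fun h => ?_, ?_⟩
        · rw [Equiv.symm_apply_eq, h1, Equiv.apply_symm_apply]
        · rw [Equiv.symm_apply_eq, h2, Equiv.apply_symm_apply]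
        · rw [← h3, Option.map_map]
          simp
      trans := by
        rintro m m' m'' ⟨e, h1, h2, h3⟩ ⟨f, g1, g2, g3⟩
        refine ⟨e.trans f, fun h => ?_, fun h => ?_, ?_⟩
        · simp [h1, g1]
        · simp [h2, g2]
        · rw [← g3, ← h3, Option.map_map]
          rfl }

theorem numVertices_eq_of_equiv {n : ℕ} (m m' : LabelledMap n) (h : m ≈ m') :
    m.numVertices = m'.numVertices := by
  obtain ⟨e, h1, -, -⟩ := h
  have key : m'.next = e * m.next * e⁻¹ := by
    ext x
    simp [h1]
  unfold numVertices
  split_ifs with hn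
  · rfl
  · refine Nat.card_congr (Quotient.congr e fun a b => ?_)
    change m.next.SameCycle a b ↔ m'.next.SameCycle (e a) (e b)
    rw [key, Equiv.Perm.sameCycle_conj]
    simp

instance finite (n : ℕ) : Finite (LabelledMap n) := by
  refine Finite.of_injective (fun m : LabelledMap n => (m.next, m.opp, m.root)) ?_
  rintro ⟨a, b, _, _, _, c, _⟩ ⟨a', b', _, _, _, c', _⟩ h
  simp only [Prod.mk.injEq] at h
  obtain ⟨rfl, rfl, rfl⟩ := h
  rfl

instance nonempty (n : ℕ) : Nonempty (LabelledMap n) := by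
  rcases Nat.eq_zero_or_pos n with rfl | hn
  · exact ⟨⟨1, 1, fun h => h.elim0, fun h => h.elim0, ⟨fun h => h.elim0⟩, none, by simp⟩⟩
  · refine ⟨⟨finRotate (2 * n), Fin.revPerm, by simp, fun h hh => ?_, ⟨fun a b => ?_⟩,
      some ⟨0, by omega⟩, by simp; omega⟩⟩
    · have := congrArg Fin.val hh
      simp only [Fin.revPerm_apply, Fin.val_rev] at this
      omega
    · have hc := isCycle_finRotate_of_le (n := 2 * n) (by omega)
      have hs : ∀ x, finRotate (2 * n) x ≠ x := fun x => by
        rw [← Equiv.Perm.mem_support, support_finRotate_of_le (by omega)]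
        exact Finset.mem_univ x
      obtain ⟨i, hi⟩ := hc.sameCycle (hs a) (hs b)
      exact ⟨⟨finRotate (2 * n) ^ i,
        Subgroup.zpow_mem _ (Subgroup.subset_closure (by simp)) i⟩, hi⟩

end LabelledMap

/-- Rooted maps with `n` edges, without restriction on the genus: isomorphism classes. -/
def RootedMap (n : ℕ) : Type := Quotient (LabelledMap.setoid n)

namespace RootedMap

/-- The number of vertices of a rooted map. -/
noncomputable def numVertices {n : ℕ} : RootedMap n → ℕ :=
  Quotient.lift LabelledMap.numVertices LabelledMap.numVertices_eq_of_equiv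

instance finite (n : ℕ) : Finite (RootedMap n) :=
  inferInstanceAs (Finite (Quotient (LabelledMap.setoid n)))

instance nonempty (n : ℕ) : Nonempty (RootedMap n) :=
  (LabelledMap.nonempty n).map (Quotient.mk (LabelledMap.setoid n))

instance measurableSpace (n : ℕ) : MeasurableSpace (RootedMap n) := ⊤

instance discreteMeasurableSpace (n : ℕ) : DiscreteMeasurableSpace (RootedMap n) :=
  ⟨fun _ => trivial⟩

/-- The uniform probability distribution on rooted maps with `n` edges. -/
noncomputable def uniform (n : ℕ) : Measure (RootedMap n) := uniformOn Set.univ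

instance isProbabilityMeasure_uniform (n : ℕ) : IsProbabilityMeasure (uniform n) :=
  isProbabilityMeasure_uniformOn Set.finite_univ Set.univ_nonempty

/-- The random variable `X_n`: the number of vertices of a rooted map, as a real number. -/
noncomputable def X (n : ℕ) (m : RootedMap n) : ℝ := m.numVertices

end RootedMap

/-! Label the half-edges. If connectedness is dropped, the vertex permutation and the edge
involution are independent, so everything factorises. The rising factorial `∏ (v + i)` over `i < 2n`
counts permutations by cycles, and there are (2n-1)!! fixed-point free involutions. Divided by
(2n)!, this is `allCoeff n v`, written A_n(v) below.

Splitting off the component of a marked half-edge (`card_mul_totalSum`) gives 2n A_n = ∑ M_k A_{n-k}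
(`two_mul_allCoeff`), that is, 2z A'(z) = M(z) A(z). A root kills all automorphisms, so a rooted map
with n ≥ 1 edges has exactly (2n)! labellings. Hence M_n(v), which is `rootedCoeff n v`, is the
vertex polynomial of rooted maps.

By Euler's limit for Γ, A_n(v) is (2n-1)!! (2n)^(v-1) / Γ(v) up to a factor 1 + O(1/n)
(`exists_norm_gammaRatio_sub_one_le`). The double factorial grows so fast that the inner terms of
the convolution are negligible (`exists_convolution_le`), and M_n = 2n A_n (1 + O(1/n))
(`exists_norm_sub_two_mul_le`): almost all maps are connected. Since A_n(1) = (2n-1)!!, the quotient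
M_n(v) / M_n(1) gives the asserted generating function, uniformly on compact sets.

The rest is a quasi-powers argument. E(v^X) n^(1-v) converges locally uniformly on Re v > 0 to a
holomorphic function. Its first two derivatives at 1 therefore converge, so mean and variance are
log n + O(1). Evaluation at v = exp(it/σ), which tends to 1, gives convergence of characteristic
functions. -/

/-! ### Cycle counts of permutations and fixed-point free involutions -/

namespace Equiv.Perm

/-- The number of cycles of a permutation, fixed points included. -/
noncomputable def cycleCount {α : Type*} (σ : Perm α) : ℕ :=
  Nat.card (Quotient (SameCycle.setoid σ))

theorem SameCycle.map_eq {α β : Type*} {σ : Perm α} {f : α → β} (h : ∀ x, f (σ x) = f x)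
    {x y : α} (hxy : σ.SameCycle x y) : f x = f y := by
  obtain ⟨i, rfl⟩ := hxy
  induction i using Int.induction_on with
  | zero => simp
  | succ i ih => rw [add_comm, zpow_add, zpow_one, mul_apply, h, ← ih]
  | pred i ih =>
    rw [ih, ← h ((σ ^ (-(i : ℤ) - 1)) x), ← mul_apply, ← zpow_one_add, add_sub_cancel]

/-- A function that is invariant under `σ`, as a function on the cycles of `σ`. -/
def cyclesLift {α β : Type*} {σ : Perm α} (f : α → β) (h : ∀ x, f (σ x) = f x) :
    Quotient (SameCycle.setoid σ) → β :=
  Quotient.lift f fun _ _ hxy => SameCycle.map_eq h hxy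

@[simp]
theorem cyclesLift_mk {α β : Type*} {σ : Perm α} (f : α → β) (h : ∀ x, f (σ x) = f x) (x : α) :
    cyclesLift f h (Quotient.mk _ x) = f x := rfl

/-- Two permutations whose orbit spaces are related by mutually inverse maps have the same number
of cycles. -/
theorem natCard_cycles_eq {α β : Type*} {σ : Perm α} (f : α → β)
    (g : β → Quotient (SameCycle.setoid σ))
    (hf : ∀ x, f (σ x) = f x) (hfg : ∀ x, g (f x) = ⟦x⟧)
    (hgf : ∀ b, cyclesLift f hf (g b) = b) :
    σ.cycleCount = Nat.card β :=
  Nat.card_congr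
    { toFun := cyclesLift f hf
      invFun := g
      left_inv := fun q => by
        induction q using Quotient.inductionOn with
        | h x => exact hfg x
      right_inv := hgf }

theorem mk_apply_eq {α : Type*} (σ : Perm α) (x : α) :
    (Quotient.mk (SameCycle.setoid σ) (σ x)) = Quotient.mk (SameCycle.setoid σ) x :=
  Quotient.sound (show σ.SameCycle (σ x) x from sameCycle_apply_left.2 (SameCycle.refl _ _))

theorem cycleCount_permCongr {α β : Type*} (e : α ≃ β) (σ : Perm α) :
    (e.permCongr σ).cycleCount = σ.cycleCount := by
  have hL : ∀ x, Quotient.mk (SameCycle.setoid (e.permCongr σ)) (e (σ x)) =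
      Quotient.mk (SameCycle.setoid (e.permCongr σ)) (e x) := fun x => by
    simpa [Equiv.permCongr_apply] using mk_apply_eq (e.permCongr σ) (e x)
  refine natCard_cycles_eq (fun x => Quotient.mk (SameCycle.setoid σ) (e.symm x))
    (cyclesLift (fun x => Quotient.mk _ (e x)) hL) ?_ ?_ ?_
  · intro x
    simp [Equiv.permCongr_apply, mk_apply_eq]
  · intro x
    simp
  · intro q
    induction q using Quotient.inductionOn with
    | h x => simp

theorem cycleCount_subtypeCongr {α : Type*} [Finite α] (p : α → Prop) [DecidablePred p]
    (σ : Perm {a // p a}) (τ : Perm {a // ¬ p a}) :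
    (σ.subtypeCongr τ).cycleCount = σ.cycleCount + τ.cycleCount := by
  have hL : ∀ x : {a // p a}, Quotient.mk (SameCycle.setoid (σ.subtypeCongr τ)) (σ x : α) =
      Quotient.mk (SameCycle.setoid (σ.subtypeCongr τ)) (x : α) := fun x => by
    rw [← subtypeCongr.left_apply_subtype σ τ x, mk_apply_eq]
  have hR : ∀ x : {a // ¬ p a}, Quotient.mk (SameCycle.setoid (σ.subtypeCongr τ)) (τ x : α) =
      Quotient.mk (SameCycle.setoid (σ.subtypeCongr τ)) (x : α) := fun x => by
    rw [← subtypeCongr.right_apply_subtype σ τ x, mk_apply_eq]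
  rw [natCard_cycles_eq (σ := σ.subtypeCongr τ)
    (β := Quotient (SameCycle.setoid σ) ⊕ Quotient (SameCycle.setoid τ))
    (fun x => if h : p x then Sum.inl (Quotient.mk _ ⟨x, h⟩) else Sum.inr (Quotient.mk _ ⟨x, h⟩))
    (Sum.elim (cyclesLift (fun x => Quotient.mk _ (x : α)) hL)
      (cyclesLift (fun x => Quotient.mk _ (x : α)) hR))]
  · rw [Nat.card_sum]; rfl
  · intro x
    by_cases h : p x
    · have h2 := (σ ⟨x, h⟩).2
      simp only [subtypeCongr.left_apply σ τ h, h2, h, dif_pos, Subtype.coe_eta, mk_apply_eq]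
    · have h2 := (τ ⟨x, h⟩).2
      simp only [subtypeCongr.right_apply σ τ h, h2, h, dif_neg, Subtype.coe_eta, mk_apply_eq,
        not_false_eq_true]
  · intro x
    by_cases h : p x <;> simp [h]
  · rintro (q | q) <;> induction q using Quotient.inductionOn with
    | h x => simp [x.2]

theorem cycleCount_optionCongr {α : Type*} [Finite α] (τ : Perm α) :
    cycleCount (Equiv.optionCongr τ) = τ.cycleCount + 1 := by
  have hL : ∀ x, Quotient.mk (SameCycle.setoid (Equiv.optionCongr τ : Perm _)) (some (τ x)) =
      Quotient.mk (SameCycle.setoid (Equiv.optionCongr τ : Perm _)) (some x) := fun x =>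
    mk_apply_eq (Equiv.optionCongr τ) (some x)
  rw [natCard_cycles_eq (σ := Equiv.optionCongr τ) (β := Option (Quotient (SameCycle.setoid τ)))
    (Option.map (Quotient.mk _))
    (fun q => q.elim (Quotient.mk _ none)
      (cyclesLift (fun x => Quotient.mk _ (some x)) hL))]
  · rw [Finite.card_option]; rfl
  · rintro (_ | x) <;> simp [mk_apply_eq]
  · rintro (_ | x) <;> simp
  · rintro (_ | q)
    · simp
    · induction q using Quotient.inductionOn with
      | h x => simp

/-- The product inserts `none` just before `a` in the cycle of `a`, so no cycle is created or
merged. -/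
theorem cycleCount_swap_mul_optionCongr {α : Type*} [DecidableEq α] (a : α) (τ : Perm α) :
    (swap none (some a) * Equiv.optionCongr τ).cycleCount = τ.cycleCount := by
  set σ := swap none (some a) * Equiv.optionCongr τ with hσ
  have h0 : σ none = some a := by simp [hσ]
  have h1 : ∀ x, τ x = a → σ (some x) = none := fun x h => by simp [hσ, h]
  have h2 : ∀ x, τ x ≠ a → σ (some x) = some (τ x) := fun x h => by
    simp [hσ, swap_apply_of_ne_of_ne, h]
  have hL : ∀ x, Quotient.mk (SameCycle.setoid σ) (some (τ x)) =
      Quotient.mk (SameCycle.setoid σ) (some x) := fun x => by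
    by_cases h : τ x = a
    · rw [h, ← h0, mk_apply_eq, ← h1 x h, mk_apply_eq]
    · rw [← h2 x h, mk_apply_eq]
  refine natCard_cycles_eq (fun x => Quotient.mk (SameCycle.setoid τ) (x.getD a))
    (cyclesLift (fun x => Quotient.mk _ (some x)) hL) ?_ ?_ ?_
  · rintro (_ | x)
    · simp [h0]
    · by_cases h : τ x = a
      · simp [h1 x h, ← h, mk_apply_eq]
      · simp [h2 x h, mk_apply_eq]
  · rintro (_ | x)
    · simp [← h0, mk_apply_eq]
    · simp
  · intro q
    induction q using Quotient.inductionOn with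
    | h x => simp

/-- A new point either forms its own cycle (weight `x`) or is inserted before one of the `m` old
points, hence the factor `x + m` at each step. -/
theorem sum_pow_cycleCount_fin {R : Type*} [CommSemiring R] (x : R) (m : ℕ) :
    ∑ σ : Perm (Fin m), x ^ σ.cycleCount = ∏ i ∈ Finset.range m, (x + i) := by
  induction m with
  | zero =>
    have : ∀ σ : Perm (Fin 0), σ.cycleCount = 0 := fun σ => by
      have : IsEmpty (Quotient (SameCycle.setoid σ)) := ⟨fun q => Quotient.inductionOn q Fin.elim0⟩
      exact Nat.card_of_isEmpty
    simp [this]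
  | succ m ih =>
    rw [Fintype.sum_equiv (finSuccEquiv m).permCongr _ (fun σ => x ^ σ.cycleCount)
      (fun σ => by rw [cycleCount_permCongr]),
      Fintype.sum_equiv decomposeOption _
        (fun p : Option (Fin m) × Perm (Fin m) => x ^ (decomposeOption.symm p).cycleCount)
        (fun σ => by simp only [Equiv.symm_apply_apply]),
      Fintype.sum_prod_type, Fintype.sum_option, Finset.prod_range_succ, ← ih]
    simp only [decomposeOption_symm_apply, cycleCount_swap_mul_optionCongr, swap_self]
    have : ∀ τ : Perm (Fin m), cycleCount ((Equiv.refl _ : Perm (Option (Fin m))) *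
      (Equiv.optionCongr τ : Perm _)) = τ.cycleCount + 1 := fun τ => cycleCount_optionCongr τ
    simp only [this, pow_succ, Finset.sum_const, Finset.card_univ, Fintype.card_fin, nsmul_eq_mul,
      ← Finset.sum_mul]
    ring

/-- These involutions form the conjugacy class of cycle type 2, ..., 2 (n times), whose size is
known. The product form avoids division in ℕ. -/
theorem card_fixedPointFree_involutions (n : ℕ) :
    Nat.card {α : Perm (Fin (2 * n)) // (∀ h, α (α h) = h) ∧ ∀ h, α h ≠ h} * (2 ^ n * n.factorial)
      = (2 * n).factorial := by
  have key : ∀ α : Perm (Fin (2 * n)), ((∀ h, α (α h) = h) ∧ ∀ h, α h ≠ h) ↔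
      α.cycleType = Multiset.replicate n 2 := by
    intro α
    constructor
    · rintro ⟨h1, h2⟩
      have hp : α ^ 2 = 1 := by ext x; simp [pow_two, h1]
      have hs : α.support = Finset.univ := by ext x; simp [h2]
      have := cycleType_of_pow_prime_eq_one (p := 2) hp
      have hsum := sum_cycleType α
      rw [this, hs, Finset.card_univ, Fintype.card_fin, Multiset.sum_replicate, smul_eq_mul] at hsum
      rw [this]
      congr 1
      omega
    · intro h
      have hs := sum_cycleType α
      rw [h, Multiset.sum_replicate, smul_eq_mul] at hs
      have hu : α.support = Finset.univ := Finset.eq_univ_of_card _ (by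
        rw [Fintype.card_fin]; omega)
      refine ⟨fun x => ?_, fun x => by rw [← mem_support, hu]; exact Finset.mem_univ _⟩
      have hd : orderOf α ∣ 2 := by
        rw [← lcm_cycleType, h]
        exact Multiset.lcm_dvd.2 fun b hb => by rw [Multiset.eq_of_mem_replicate hb]
      have := orderOf_dvd_iff_pow_eq_one.1 hd
      rw [← mul_apply, ← pow_two, this, one_apply]
  have hc := card_of_cycleType_mul_eq (Fin (2 * n)) (Multiset.replicate n 2)
  rw [if_pos ⟨by simp [mul_comm], fun a ha => by rw [Multiset.eq_of_mem_replicate ha]⟩] at hc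
  rw [Nat.card_congr (Equiv.subtypeEquivRight key), Nat.card_eq_fintype_card, Fintype.card_subtype]
  rw [Fintype.card_fin] at hc
  rw [← hc]
  congr 1
  rcases Nat.eq_zero_or_pos n with rfl | hn
  · simp
  · simp [mul_comm n 2, Multiset.toFinset_replicate, hn.ne']

end Equiv.Perm

/-! ### Labelled maps and the decomposition by the component of a half-edge -/

/-- A permutation of `V` together with a fixed-point free involution of `V`: a map, not necessarily
connected, with set of half-edges `V`. -/
@[ext]
structure HalfEdgeMap (V : Type*) where
  next : Equiv.Perm V
  opp : Equiv.Perm V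
  opp_opp : ∀ h, opp (opp h) = h
  opp_ne : ∀ h, opp h ≠ h

namespace HalfEdgeMap

variable {V W : Type*}

/-- The half-edge `y` is reached from `x`. -/
def Reach (p : HalfEdgeMap V) : V → V → Prop :=
  Relation.ReflTransGen fun x y => y = p.next x ∨ y = p.opp x

/-- Every half-edge is reached from every other. -/
def Connected (p : HalfEdgeMap V) : Prop := ∀ x y, p.Reach x y

instance [Finite V] : Finite (HalfEdgeMap V) :=
  Finite.of_injective (fun p : HalfEdgeMap V => (p.next, p.opp)) fun p q h => by
    simp only [Prod.mk.injEq] at h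
    exact HalfEdgeMap.ext h.1 h.2

noncomputable instance [Finite V] : Fintype (HalfEdgeMap V) := Fintype.ofFinite _

noncomputable instance [Finite V] : Fintype {p : HalfEdgeMap V // p.Connected} := Fintype.ofFinite _

theorem mem_of_reach {p : HalfEdgeMap V} {s : Set V} (h1 : ∀ x ∈ s, p.next x ∈ s)
    (h2 : ∀ x ∈ s, p.opp x ∈ s) {x y : V} (h : p.Reach x y) (hx : x ∈ s) : y ∈ s := by
  induction h with
  | refl => exact hx
  | tail _ h ih =>
    rcases h with rfl | rfl
    · exact h1 _ ih
    · exact h2 _ ih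

theorem Reach.fst {p : HalfEdgeMap V} {r x : V} (h : p.Reach r x) : p.Reach r (p.next x) :=
  h.tail (Or.inl rfl)

theorem Reach.snd {p : HalfEdgeMap V} {r x : V} (h : p.Reach r x) : p.Reach r (p.opp x) :=
  h.tail (Or.inr rfl)

theorem reach_snd_iff {p : HalfEdgeMap V} {r x : V} : p.Reach r (p.opp x) ↔ p.Reach r x :=
  ⟨fun h => by simpa [p.opp_opp] using h.snd, Reach.snd⟩

/-- On a finite set, following `next` from `next x` eventually returns to `x`. This is why `Reach`,
which only allows forward steps, is symmetric. -/
theorem reach_fst_iff [Finite V] {p : HalfEdgeMap V} {r x : V} :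
    p.Reach r (p.next x) ↔ p.Reach r x := by
  refine ⟨fun h => ?_, Reach.fst⟩
  have key : ∀ n : ℕ, p.Reach r ((p.next ^ n) (p.next x)) := fun n => by
    induction n with
    | zero => simpa using h
    | succ n ih => rw [pow_succ', Equiv.Perm.mul_apply]; exact ih.fst
  obtain ⟨n, hn⟩ := (Equiv.Perm.SameCycle.refl p.next x).apply_left.exists_nat_pow_eq
  exact hn ▸ key n

theorem reach_symm [Finite V] {p : HalfEdgeMap V} {x y : V} (h : p.Reach x y) : p.Reach y x := by
  induction h with
  | refl => exact Relation.ReflTransGen.refl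
  | tail _ h ih =>
    refine Relation.ReflTransGen.trans ?_ ih
    rcases h with rfl | rfl
    · exact reach_fst_iff.1 Relation.ReflTransGen.refl
    · exact reach_snd_iff.1 Relation.ReflTransGen.refl

theorem isPretransitive_iff [Finite V] (p : HalfEdgeMap V) :
    MulAction.IsPretransitive (Subgroup.closure {p.next, p.opp}) V ↔ p.Connected := by
  constructor
  · intro H x y
    have key : ∀ g ∈ Subgroup.closure {p.next, p.opp}, ∀ x : V, p.Reach x (g x) := by
      intro g hg
      induction hg using Subgroup.closure_induction with
      | mem g hg =>
        intro x
        rcases hg with rfl | rfl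
        · exact Reach.fst Relation.ReflTransGen.refl
        · exact Reach.snd Relation.ReflTransGen.refl
      | one => exact fun x => Relation.ReflTransGen.refl
      | mul g g' _ _ h h' => exact fun x => (h' x).trans (h (g' x))
      | inv g _ h =>
        intro x
        simpa using reach_symm (h (g⁻¹ x))
    obtain ⟨g, hg⟩ := H.exists_smul_eq x y
    rw [← hg]
    exact key g.1 g.2 x
  · intro H
    refine ⟨fun x y => ?_⟩
    refine mem_of_reach (s := {y | ∃ g : Subgroup.closure {p.next, p.opp}, g • x = y})
      ?_ ?_ (H x y) ⟨1, one_smul _ _⟩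
    · rintro _ ⟨g, rfl⟩
      exact ⟨⟨p.next, Subgroup.subset_closure (by simp)⟩ * g, rfl⟩
    · rintro _ ⟨g, rfl⟩
      exact ⟨⟨p.opp, Subgroup.subset_closure (by simp)⟩ * g, rfl⟩

/-- Transport of a map along a bijection of the half-edges. -/
def congr (e : V ≃ W) : HalfEdgeMap V ≃ HalfEdgeMap W where
  toFun p := ⟨e.permCongr p.next, e.permCongr p.opp, fun h => by
    simp [Equiv.permCongr_apply, p.opp_opp], fun h H => p.opp_ne (e.symm h) <| e.injective <| by
    simpa [Equiv.permCongr_apply] using H⟩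
  invFun p := ⟨e.symm.permCongr p.next, e.symm.permCongr p.opp, fun h => by
    simp [Equiv.permCongr_apply, p.opp_opp], fun h H => p.opp_ne (e h) <| e.symm.injective <| by
    simpa [Equiv.permCongr_apply] using H⟩
  left_inv p := by ext <;> simp [Equiv.permCongr_apply]
  right_inv p := by ext <;> simp [Equiv.permCongr_apply]

theorem reach_congr (e : V ≃ W) (p : HalfEdgeMap V) {x y : V} (h : p.Reach x y) :
    (congr e p).Reach (e x) (e y) := by
  refine Relation.ReflTransGen.lift e ?_ _ _ h
  rintro a b (rfl | rfl)
  · left; simp [congr, Equiv.permCongr_apply]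
  · right; simp [congr, Equiv.permCongr_apply]

theorem connected_congr_of (e : V ≃ W) (p : HalfEdgeMap V) (h : p.Connected) :
    (congr e p).Connected := fun x y => by
  simpa using reach_congr e p (h (e.symm x) (e.symm y))

theorem connected_congr (e : V ≃ W) (p : HalfEdgeMap V) :
    (congr e p).Connected ↔ p.Connected := by
  refine ⟨fun h => ?_, connected_congr_of e p⟩
  have := connected_congr_of e.symm _ h
  rwa [show congr e.symm (congr e p) = p from (congr e).symm_apply_apply p] at this

/-- The sum of `x ^ vertices` over all maps with set of half-edges `V`. -/
noncomputable def totalSum (V : Type*) [Finite V] (x : ℂ) : ℂ :=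
  ∑ p : HalfEdgeMap V, x ^ p.next.cycleCount

/-- The sum of `x ^ vertices` over all connected maps with set of half-edges `V`. -/
noncomputable def connSum (V : Type*) [Finite V] (x : ℂ) : ℂ :=
  ∑ p : {p : HalfEdgeMap V // p.Connected}, x ^ p.1.next.cycleCount

theorem totalSum_congr [Finite V] [Finite W] (e : V ≃ W) (x : ℂ) :
    totalSum V x = totalSum W x :=
  Fintype.sum_equiv (congr e) _ _ fun p => by
    rw [show (congr e p).next = e.permCongr p.next from rfl, Equiv.Perm.cycleCount_permCongr]

theorem connSum_congr [Finite V] [Finite W] (e : V ≃ W) (x : ℂ) :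
    connSum V x = connSum W x :=
  Fintype.sum_equiv ((congr e).subtypeEquiv fun p => (connected_congr e p).symm) _ _ fun p => by
    rw [show ((congr e).subtypeEquiv (fun p => (connected_congr e p).symm) p).1.next =
      e.permCongr p.1.next from rfl, Equiv.Perm.cycleCount_permCongr]

/-- The half-edges that can be reached from `r`. -/
noncomputable def component [Fintype V] (p : HalfEdgeMap V) (r : V) : Finset V :=
  (Set.toFinite {x | p.Reach r x}).toFinset

@[simp]
theorem mem_component [Fintype V] {p : HalfEdgeMap V} {r x : V} :
    x ∈ p.component r ↔ p.Reach r x := by simp [component]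

/-- Disjoint union of two maps. -/
def glue (P : V → Prop) [DecidablePred P] (q : HalfEdgeMap {x // P x})
    (q' : HalfEdgeMap {x // ¬ P x}) : HalfEdgeMap V where
  next := q.next.subtypeCongr q'.next
  opp := q.opp.subtypeCongr q'.opp
  opp_opp h := by
    by_cases hh : P h
    · rw [Equiv.Perm.subtypeCongr.left_apply _ _ hh, Equiv.Perm.subtypeCongr.left_apply_subtype,
        q.opp_opp]
    · rw [Equiv.Perm.subtypeCongr.right_apply _ _ hh,
        Equiv.Perm.subtypeCongr.right_apply_subtype, q'.opp_opp]
  opp_ne h := by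
    by_cases hh : P h
    · rw [Equiv.Perm.subtypeCongr.left_apply _ _ hh]
      exact fun H => q.opp_ne ⟨h, hh⟩ (Subtype.ext H)
    · rw [Equiv.Perm.subtypeCongr.right_apply _ _ hh]
      exact fun H => q'.opp_ne ⟨h, hh⟩ (Subtype.ext H)

/-- Restriction of a map to an invariant set of half-edges. -/
def restrict (P : V → Prop) (p : HalfEdgeMap V) (h1 : ∀ x, P (p.next x) ↔ P x)
    (h2 : ∀ x, P (p.opp x) ↔ P x) : HalfEdgeMap {x // P x} where
  next := p.next.subtypePerm h1
  opp := p.opp.subtypePerm h2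
  opp_opp h := Subtype.ext (p.opp_opp h)
  opp_ne h H := p.opp_ne h (congrArg Subtype.val H)

theorem glue_left_fst (P : V → Prop) [DecidablePred P] (q : HalfEdgeMap {x // P x})
    (q' : HalfEdgeMap {x // ¬ P x}) (x : {x // P x}) : (glue P q q').next x = q.next x :=
  Equiv.Perm.subtypeCongr.left_apply_subtype _ _ x

theorem glue_left_snd (P : V → Prop) [DecidablePred P] (q : HalfEdgeMap {x // P x})
    (q' : HalfEdgeMap {x // ¬ P x}) (x : {x // P x}) : (glue P q q').opp x = q.opp x :=
  Equiv.Perm.subtypeCongr.left_apply_subtype _ _ x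

theorem component_glue [Fintype V] [DecidableEq V] {S : Finset V} {r : V} (hr : r ∈ S)
    (q : HalfEdgeMap {x // x ∈ S}) (q' : HalfEdgeMap {x // x ∉ S}) (hq : q.Connected) :
    (glue (· ∈ S) q q').component r = S := by
  ext x
  rw [mem_component]
  constructor
  · intro h
    refine mem_of_reach (s := (S : Set V)) ?_ ?_ h hr
    · intro y hy
      rw [glue_left_fst (· ∈ S) q q' ⟨y, hy⟩]
      exact (q.next ⟨y, hy⟩).2
    · intro y hy
      rw [glue_left_snd (· ∈ S) q q' ⟨y, hy⟩]
      exact (q.opp ⟨y, hy⟩).2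
  · intro hx
    refine Relation.ReflTransGen.lift Subtype.val ?_ _ _ (hq ⟨r, hr⟩ ⟨x, hx⟩)
    rintro a b (rfl | rfl)
    · left; rw [glue_left_fst (· ∈ S)]
    · right; rw [glue_left_snd (· ∈ S)]

theorem reach_restrict (P : V → Prop) (p : HalfEdgeMap V) (h1 : ∀ x, P (p.next x) ↔ P x)
    (h2 : ∀ x, P (p.opp x) ↔ P x) (x : {x // P x}) {y : V} (h : p.Reach x y) :
    ∃ hy : P y, (restrict P p h1 h2).Reach x ⟨y, hy⟩ := by
  induction h with
  | refl => exact ⟨x.2, Relation.ReflTransGen.refl⟩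
  | tail _ h ih =>
    obtain ⟨hb, hr⟩ := ih
    rcases h with rfl | rfl
    · exact ⟨(h1 _).2 hb, hr.tail (Or.inl rfl)⟩
    · exact ⟨(h2 _).2 hb, hr.tail (Or.inr rfl)⟩

/-- A map in which the component of `r` is `S` is a connected map on `S` and a map on the
complement of `S`. -/
noncomputable def componentEquiv [Fintype V] [DecidableEq V] (S : Finset V) (r : V) (hr : r ∈ S) :
    {p : HalfEdgeMap V // p.component r = S} ≃
      {q : HalfEdgeMap {x // x ∈ S} // q.Connected} × HalfEdgeMap {x // x ∉ S} where
  toFun p :=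
    have h1 : ∀ x, p.1.next x ∈ S ↔ x ∈ S := fun x => by
      simpa only [← mem_component, p.2] using reach_fst_iff (p := p.1) (r := r) (x := x)
    have h2 : ∀ x, p.1.opp x ∈ S ↔ x ∈ S := fun x => by
      simpa only [← mem_component, p.2] using reach_snd_iff (p := p.1) (r := r) (x := x)
    (⟨restrict (· ∈ S) p.1 h1 h2, fun x y => by
      have hx := x.2
      have hy := y.2
      simp only [← p.2, mem_component] at hx hy
      exact (reach_restrict _ _ h1 h2 x ((reach_symm hx).trans hy)).2⟩,
      restrict (· ∉ S) p.1 (fun x => (h1 x).not) (fun x => (h2 x).not))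
  invFun q := ⟨glue (· ∈ S) q.1.1 q.2, component_glue hr _ _ q.1.2⟩
  left_inv p := by
    refine Subtype.ext (HalfEdgeMap.ext ?_ ?_) <;> ext x
    all_goals
      by_cases hx : x ∈ S <;> simp [glue, restrict, hx]
  right_inv q := by
    refine Prod.ext (Subtype.ext (HalfEdgeMap.ext ?_ ?_)) (HalfEdgeMap.ext ?_ ?_) <;> ext x
    all_goals
      simp [glue, restrict, x.2]

theorem sum_component_eq [Fintype V] [DecidableEq V] (S : Finset V) (r : V) (hr : r ∈ S) (x : ℂ) :
    ∑ p : HalfEdgeMap V with p.component r = S, x ^ p.next.cycleCount =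
      connSum {x // x ∈ S} x * totalSum {x // x ∉ S} x := by
  rw [connSum, totalSum, Finset.sum_mul_sum, ← Finset.sum_product', Finset.univ_product_univ,
    Finset.sum_subtype (p := fun p : HalfEdgeMap V => p.component r = S) _ (by simp)]
  refine (Fintype.sum_equiv (componentEquiv S r hr).symm _ _ fun q => ?_).symm
  rw [← pow_add]
  exact congrArg _ (Equiv.Perm.cycleCount_subtypeCongr (· ∈ S) q.1.1.next q.2.next).symm

/-- Mark a half-edge `r` and classify maps by its component `S`, which carries a connected map while
the complement carries an arbitrary one. Summation over `r` counts each `S` once per element, which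
produces the factor `k`. -/
theorem card_mul_totalSum (N : ℕ) (x : ℂ) :
    N * totalSum (Fin N) x = ∑ k ∈ Finset.range (N + 1),
      (N.choose k : ℂ) * (k * connSum (Fin k) x * totalSum (Fin (N - k)) x) := by
  have h1 : ∀ r : Fin N, totalSum (Fin N) x = ∑ S : Finset (Fin N),
      if r ∈ S then connSum (Fin S.card) x * totalSum (Fin (N - S.card)) x else 0 := by
    intro r
    rw [totalSum, ← Finset.sum_fiberwise _ (fun p => component p r)]
    refine Finset.sum_congr rfl fun S _ => ?_
    split_ifs with hr
    · rw [sum_component_eq S r hr, connSum_congr S.equivFin,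
        totalSum_congr (Fintype.equivFinOfCardEq
          (show Fintype.card {x // x ∉ S} = N - S.card by simp [Fintype.card_subtype_compl]))]
    · refine Finset.sum_eq_zero fun p hp => absurd ?_ hr
      rw [← (Finset.mem_filter.1 hp).2, mem_component]
      exact Relation.ReflTransGen.refl
  have h2 : (N : ℂ) * totalSum (Fin N) x = ∑ _r : Fin N, totalSum (Fin N) x := by simp
  rw [h2, Finset.sum_congr rfl fun r _ => h1 r, Finset.sum_comm]
  have h3 := Finset.sum_powerset_apply_card (x := (Finset.univ : Finset (Fin N)))
    fun k => (k : ℂ) * connSum (Fin k) x * totalSum (Fin (N - k)) x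
  rw [Finset.powerset_univ] at h3
  simp only [Finset.card_univ, Fintype.card_fin, nsmul_eq_mul] at h3
  rw [← h3]
  refine Finset.sum_congr rfl fun S _ => ?_
  rw [← Finset.sum_filter, Finset.sum_const, nsmul_eq_mul, mul_assoc]
  congr 3
  simp

/-! ### Generating coefficients and the recursion between all maps and rooted maps -/

theorem totalSum_two_mul (n : ℕ) (x : ℂ) :
    totalSum (Fin (2 * n)) x * (2 ^ n * n.factorial) =
      (2 * n).factorial * ∏ i ∈ Finset.range (2 * n), (x + i) := by
  let e : HalfEdgeMap (Fin (2 * n)) ≃ Equiv.Perm (Fin (2 * n)) ×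
      {α : Equiv.Perm (Fin (2 * n)) // (∀ h, α (α h) = h) ∧ ∀ h, α h ≠ h} :=
    { toFun := fun p => (p.next, ⟨p.opp, p.opp_opp, p.opp_ne⟩)
      invFun := fun q => ⟨q.1, q.2.1, q.2.2.1, q.2.2.2⟩
      left_inv := fun _ => rfl
      right_inv := fun _ => rfl }
  rw [totalSum, Fintype.sum_equiv e (fun p => x ^ p.next.cycleCount)
    (fun q => x ^ q.1.cycleCount) fun _ => rfl, Fintype.sum_prod_type]
  simp only [Finset.sum_const, ← Finset.smul_sum, Equiv.Perm.sum_pow_cycleCount_fin]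
  rw [← Equiv.Perm.card_fixedPointFree_involutions n, Nat.card_eq_fintype_card, Finset.card_univ,
    nsmul_eq_mul]
  push_cast
  ring

theorem isEmpty_of_odd (k : ℕ) : IsEmpty (HalfEdgeMap (Fin (2 * k + 1))) := by
  refine ⟨fun p => ?_⟩
  have hp : p.opp ^ 2 = 1 := by ext x; simp [pow_two, p.opp_opp]
  have hs : p.opp.support = Finset.univ := by ext x; simp [p.opp_ne]
  have := Equiv.Perm.two_dvd_card_support hp
  rw [hs, Finset.card_univ, Fintype.card_fin] at this
  omega

theorem connSum_odd (k : ℕ) (x : ℂ) : connSum (Fin (2 * k + 1)) x = 0 := by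
  have := isEmpty_of_odd k
  exact Finset.sum_of_isEmpty _

/-- The exponential generating coefficient of all maps with `n` edges, by number of vertices. -/
noncomputable def allCoeff (n : ℕ) (x : ℂ) : ℂ :=
  (∏ i ∈ Finset.range (2 * n), (x + i)) / (2 ^ n * n.factorial)

/-- The exponential generating coefficient of connected maps with `n` edges and a distinguished
half-edge, by number of vertices. -/
noncomputable def rootedCoeff (n : ℕ) (x : ℂ) : ℂ :=
  2 * n * connSum (Fin (2 * n)) x / (2 * n).factorial

theorem totalSum_eq (n : ℕ) (x : ℂ) :
    totalSum (Fin (2 * n)) x = (2 * n).factorial * allCoeff n x := by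
  have := totalSum_two_mul n x
  have h2 : (2 ^ n * n.factorial : ℂ) ≠ 0 :=
    mul_ne_zero (by simp) (Nat.cast_ne_zero.2 n.factorial_ne_zero)
  rw [allCoeff, ← mul_div_assoc, eq_div_iff h2, this]

theorem sum_range_two_mul_add_one {M : Type*} [AddCommMonoid M] (f : ℕ → M) (n : ℕ)
    (hf : ∀ k, f (2 * k + 1) = 0) :
    ∑ k ∈ Finset.range (2 * n + 1), f k = ∑ k ∈ Finset.range (n + 1), f (2 * k) := by
  induction n with
  | zero => simp
  | succ n ih =>
    rw [show 2 * (n + 1) + 1 = 2 * n + 1 + 1 + 1 by ring, Finset.sum_range_succ,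
      Finset.sum_range_succ, ih, hf, Finset.sum_range_succ _ (n + 1), add_zero]
    rfl

/-- This is `card_mul_totalSum` divided by (2n)!. Odd component sizes drop out because a set of odd
size has no fixed-point free involution. -/
theorem two_mul_allCoeff (n : ℕ) (x : ℂ) :
    2 * n * allCoeff n x =
      ∑ k ∈ Finset.range (n + 1), rootedCoeff k x * allCoeff (n - k) x := by
  have h := card_mul_totalSum (2 * n) x
  rw [sum_range_two_mul_add_one _ n (fun k => by rw [connSum_odd]; simp), totalSum_eq] at h
  have hn : ((2 * n).factorial : ℂ) ≠ 0 := Nat.cast_ne_zero.2 (Nat.factorial_ne_zero _)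
  refine mul_left_cancel₀ hn ?_
  rw [Finset.mul_sum]
  push_cast at h
  rw [show ((2 * n).factorial : ℂ) * (2 * n * allCoeff n x) =
    2 * n * ((2 * n).factorial * allCoeff n x) by ring, h]
  refine Finset.sum_congr rfl fun k hk => ?_
  have hk : k ≤ n := Nat.lt_succ_iff.1 (Finset.mem_range.1 hk)
  rw [← Nat.mul_sub, totalSum_eq, rootedCoeff, Nat.mul_sub,
    ← Nat.choose_mul_factorial_mul_factorial (show 2 * k ≤ 2 * n by omega)]
  have : ((2 * k).factorial : ℂ) ≠ 0 := Nat.cast_ne_zero.2 (Nat.factorial_ne_zero _)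
  push_cast
  field_simp

end HalfEdgeMap

/-! ### Passage from labelled maps to isomorphism classes of rooted maps -/

namespace LabelledMap

/-- Relabelling of the half-edges. -/
def relabel {n : ℕ} (m : LabelledMap n) (e : Equiv.Perm (Fin (2 * n))) : LabelledMap n where
  next := e.permCongr m.next
  opp := e.permCongr m.opp
  opp_opp h := by simp [m.opp_opp]
  opp_ne h H := m.opp_ne (e.symm h) <| e.injective <| by simpa [Equiv.permCongr_apply] using H
  connected := (HalfEdgeMap.isPretransitive_iff
    (HalfEdgeMap.congr e ⟨m.next, m.opp, m.opp_opp, m.opp_ne⟩)).2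
      (HalfEdgeMap.connected_congr_of e _ ((HalfEdgeMap.isPretransitive_iff _).1 m.connected))
  root := m.root.map e
  root_eq_none_iff := by rw [Option.map_eq_none_iff, m.root_eq_none_iff]

theorem isIso_relabel {n : ℕ} (m : LabelledMap n) (e : Equiv.Perm (Fin (2 * n))) :
    IsIso m (m.relabel e) e := by
  refine ⟨fun h => ?_, fun h => ?_, rfl⟩ <;> simp [relabel]

theorem ext_of {n : ℕ} {m m' : LabelledMap n} (h1 : m.next = m'.next) (h2 : m.opp = m'.opp)
    (h3 : m.root = m'.root) : m = m' := by
  cases m; cases m'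
  subst h1 h2 h3
  rfl

theorem eq_relabel {n : ℕ} {m m' : LabelledMap n} {e : Equiv.Perm (Fin (2 * n))}
    (h : IsIso m m' e) : m' = m.relabel e := by
  refine ext_of ?_ ?_ h.2.2.symm
  · ext x
    have := h.1 (e.symm x)
    rw [Equiv.apply_symm_apply] at this
    rw [← this]
    simp [relabel]
  · ext x
    have := h.2.1 (e.symm x)
    rw [Equiv.apply_symm_apply] at this
    rw [← this]
    simp [relabel]

/-- An isomorphism of rooted maps is determined by its source and target. -/
theorem isIso_unique {n : ℕ} (hn : n ≠ 0) {m m' : LabelledMap n} {e f : Equiv.Perm (Fin (2 * n))}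
    (he : IsIso m m' e) (hf : IsIso m m' f) : e = f := by
  obtain ⟨r, hr⟩ := Option.ne_none_iff_exists'.1 (mt m.root_eq_none_iff.1 hn)
  have hroot : e r = f r := by
    have := he.2.2.trans hf.2.2.symm
    simpa [hr] using this
  have hconn := (HalfEdgeMap.isPretransitive_iff ⟨m.next, m.opp, m.opp_opp, m.opp_ne⟩).1 m.connected
  ext1 x
  refine HalfEdgeMap.mem_of_reach (s := {x | e x = f x}) ?_ ?_ (hconn r x) hroot
  · intro y hy
    rw [Set.mem_ofPred_eq] at hy ⊢
    rw [he.1, hf.1, hy]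
  · intro y hy
    rw [Set.mem_ofPred_eq] at hy ⊢
    rw [he.2.1, hf.2.1, hy]

/-- A rooted map with `n ≥ 1` edges has `(2n)!` labellings. -/
theorem card_equiv_class {n : ℕ} (hn : n ≠ 0) (m : LabelledMap n) :
    Nat.card {m' : LabelledMap n // m ≈ m'} = (2 * n).factorial := by
  -- Relabelling acts simply transitively on the class: freeness is `isIso_unique`, transitivity is
  -- `eq_relabel`.
  have e : Equiv.Perm (Fin (2 * n)) ≃ {m' : LabelledMap n // m ≈ m'} :=
    Equiv.ofBijective (fun e => ⟨m.relabel e, e, isIso_relabel m e⟩) <| by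
      constructor
      · intro e f h
        have h := congrArg Subtype.val h
        refine isIso_unique hn (isIso_relabel m e) ?_
        rw [show m.relabel e = m.relabel f from h]
        exact isIso_relabel m f
      · rintro ⟨m', e, he⟩
        exact ⟨e, Subtype.ext (eq_relabel he).symm⟩
  rw [← Nat.card_congr e, Nat.card_eq_fintype_card, Fintype.card_perm, Fintype.card_fin]

noncomputable instance (n : ℕ) : Fintype (LabelledMap n) := Fintype.ofFinite _

/-- A labelled rooted map with `n ≥ 1` edges is a connected map with a distinguished half-edge. -/
def equivConnected {n : ℕ} (hn : n ≠ 0) :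
    LabelledMap n ≃ {p : HalfEdgeMap (Fin (2 * n)) // p.Connected} × Fin (2 * n) where
  toFun m := (⟨⟨m.next, m.opp, m.opp_opp, m.opp_ne⟩,
    (HalfEdgeMap.isPretransitive_iff _).1 m.connected⟩,
    m.root.get (Option.isSome_iff_ne_none.2 (mt m.root_eq_none_iff.1 hn)))
  invFun q := ⟨q.1.1.next, q.1.1.opp, q.1.1.opp_opp, q.1.1.opp_ne,
    (HalfEdgeMap.isPretransitive_iff _).2 q.1.2, some q.2, by simp [hn]⟩
  left_inv m := ext_of rfl rfl (by simp)
  right_inv q := by simp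

theorem sum_pow_numVertices {n : ℕ} (hn : n ≠ 0) (x : ℂ) :
    ∑ m : LabelledMap n, x ^ m.numVertices = 2 * n * HalfEdgeMap.connSum (Fin (2 * n)) x := by
  rw [Fintype.sum_equiv (equivConnected hn) _ (fun q => x ^ q.1.1.next.cycleCount),
    Fintype.sum_prod_type]
  · simp only [Finset.sum_const, Finset.card_univ, Fintype.card_fin, nsmul_eq_mul,
      ← Finset.mul_sum]
    push_cast
    rfl
  · intro m
    rw [numVertices, if_neg hn]
    rfl

end LabelledMap

namespace RootedMap

noncomputable instance (n : ℕ) : Fintype (RootedMap n) := Fintype.ofFinite _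

/-- The rooted map represented by a labelled rooted map. -/
def mk {n : ℕ} (m : LabelledMap n) : RootedMap n := Quotient.mk (LabelledMap.setoid n) m

theorem mk_eq_mk {n : ℕ} {m m' : LabelledMap n} : mk m = mk m' ↔ m ≈ m' := Quotient.eq

theorem mk_surjective (n : ℕ) : Function.Surjective (mk : LabelledMap n → RootedMap n) :=
  Quotient.mk_surjective

theorem numVertices_mk {n : ℕ} (m : LabelledMap n) : (mk m).numVertices = m.numVertices := rfl

/-- Each fibre of `mk` has (2n)! elements with the same number of vertices, which cancels the
factorial in `rootedCoeff`. At `n = 0` the identity fails: the coefficient is 0, but there is one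
map. -/
theorem sum_pow_numVertices {n : ℕ} (hn : n ≠ 0) (x : ℂ) :
    ∑ m : RootedMap n, x ^ m.numVertices = HalfEdgeMap.rootedCoeff n x := by
  classical
  have hf : ((2 * n).factorial : ℂ) ≠ 0 := Nat.cast_ne_zero.2 (Nat.factorial_ne_zero _)
  rw [HalfEdgeMap.rootedCoeff, eq_div_iff hf, ← LabelledMap.sum_pow_numVertices hn,
    ← Finset.sum_fiberwise _ mk, Finset.sum_mul]
  refine Finset.sum_congr rfl fun c _ => ?_
  obtain ⟨m, rfl⟩ := mk_surjective n c
  have h1 : ∀ m' ∈ Finset.univ.filter (fun m' : LabelledMap n => mk m' = mk m),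
      x ^ m'.numVertices = x ^ m.numVertices := fun m' hm' => by
    rw [← numVertices_mk, (Finset.mem_filter.1 hm').2, numVertices_mk]
  rw [Finset.sum_congr rfl h1, Finset.sum_const, nsmul_eq_mul, mul_comm, numVertices_mk]
  congr 2
  rw [← LabelledMap.card_equiv_class hn m, Nat.card_eq_fintype_card, Fintype.card_subtype]
  congr 1
  ext m'
  simp only [Finset.mem_filter, Finset.mem_univ, true_and, mk_eq_mk]
  exact ⟨Setoid.symm, Setoid.symm⟩

theorem integral_uniform {E : Type*} [NormedAddCommGroup E] [NormedSpace ℝ E]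
    [CompleteSpace E] (n : ℕ)
    (f : RootedMap n → E) :
    ∫ m, f m ∂(uniform n) = (Fintype.card (RootedMap n) : ℝ)⁻¹ • ∑ m, f m := by
  rw [integral_fintype Integrable.of_finite, Finset.smul_sum]
  refine Finset.sum_congr rfl fun m _ => ?_
  rw [Measure.real, uniform, uniformOn_univ, Measure.count_singleton]
  simp

theorem rootedCoeff_one {n : ℕ} (hn : n ≠ 0) :
    HalfEdgeMap.rootedCoeff n 1 = Fintype.card (RootedMap n) := by
  rw [← sum_pow_numVertices hn]
  simp

theorem rootedCoeff_one_ne_zero {n : ℕ} (hn : n ≠ 0) : HalfEdgeMap.rootedCoeff n 1 ≠ 0 := by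
  rw [rootedCoeff_one hn]
  exact Nat.cast_ne_zero.2 Fintype.card_ne_zero

theorem integral_pow_numVertices {n : ℕ} (hn : n ≠ 0) (v : ℂ) :
    ∫ m, v ^ m.numVertices ∂(uniform n) =
      HalfEdgeMap.rootedCoeff n v / HalfEdgeMap.rootedCoeff n 1 := by
  rw [integral_uniform, sum_pow_numVertices hn, rootedCoeff_one hn, div_eq_inv_mul]
  simp [Complex.real_smul]

end RootedMap

/-! ### Quantitative asymptotics of Γ(v + m) / m!, uniform on compact sets -/

theorem norm_mul_sub_one_le {a b : ℂ} {C D x : ℝ} (hx : 1 ≤ x) (hC : 0 ≤ C) (hD : 0 ≤ D)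
    (ha : ‖a - 1‖ ≤ C / x) (hb : ‖b - 1‖ ≤ D / x) :
    ‖a * b - 1‖ ≤ (C + D + C * D) / x := by
  have hx0 : 0 < x := by linarith
  have h : a * b - 1 = (a - 1) + (b - 1) + (a - 1) * (b - 1) := by ring
  rw [h]
  refine (norm_add_le _ _).trans ?_
  rw [norm_mul]
  have h1 : ‖a - 1‖ * ‖b - 1‖ ≤ C / x * (D / x) := by gcongr
  have h2 : C / x * (D / x) ≤ C * D / x := by
    rw [div_mul_div_comm]
    exact div_le_div_of_nonneg_left (by positivity) hx0 (by nlinarith)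
  rw [add_div, add_div]
  linarith [norm_add_le (a - 1) (b - 1)]

/-- A sequence with `z (m + 1) / z m = 1 + O(1 / m ^ 2)` approaches its limit at speed `1 / m`. -/
theorem norm_sub_one_le_of_ratio {z : ℕ → ℂ} {B C : ℝ} (hC : 0 ≤ C)
    (hz : Tendsto z atTop (𝓝 1)) (h1 : ‖z 1‖ ≤ B)
    (h : ∀ m : ℕ, 1 ≤ m → ‖z (m + 1) - z m‖ ≤ C / m ^ 2 * ‖z m‖) (m : ℕ) (hm : 1 ≤ m) :
    ‖z m - 1‖ ≤ 2 * C * (B * Real.exp (2 * C)) / m := by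
  have hB : 0 ≤ B := (norm_nonneg _).trans h1
  -- A telescoping majorant, valid because m + 1 ≤ 2m. It first bounds the whole sequence through 1
  -- + x ≤ exp x, then sums the increments from `m` to infinity.
  have hstep : ∀ m : ℕ, 1 ≤ m → C / (m : ℝ) ^ 2 ≤ 2 * C * (1 / m - 1 / (m + 1 : ℕ)) := by
    intro m hm
    have hm' : (1 : ℝ) ≤ m := by exact_mod_cast hm
    have : 2 * C * (1 / m - 1 / (m + 1 : ℕ)) - C / (m : ℝ) ^ 2 =
        C * (m - 1) / (m ^ 2 * (m + 1)) := by
      push_cast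
      field_simp
      ring
    have h2 : 0 ≤ C * (m - 1) / ((m : ℝ) ^ 2 * (m + 1)) :=
      div_nonneg (mul_nonneg hC (by linarith)) (by positivity)
    linarith
  have hbd : ∀ m : ℕ, 1 ≤ m → ‖z m‖ ≤ B * Real.exp (2 * C * (1 - 1 / m)) := by
    intro m hm
    induction m, hm using Nat.le_induction with
    | base => simpa using h1
    | succ m hm ih =>
      have e : z (m + 1) = z m + (z (m + 1) - z m) := by ring
      calc ‖z (m + 1)‖ ≤ ‖z m‖ + ‖z (m + 1) - z m‖ := by
            conv_lhs => rw [e]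
            exact norm_add_le _ _
        _ ≤ (C / m ^ 2 + 1) * ‖z m‖ := by linarith [h m hm]
        _ ≤ Real.exp (2 * C * (1 / m - 1 / (m + 1 : ℕ))) *
            (B * Real.exp (2 * C * (1 - 1 / m))) := by
            gcongr
            exact (add_le_add_left (hstep m hm) 1).trans (Real.add_one_le_exp _)
        _ = B * Real.exp (2 * C * (1 - 1 / (m + 1 : ℕ))) := by
            rw [mul_left_comm, ← Real.exp_add]
            ring_nf
  have hbd' : ∀ m : ℕ, 1 ≤ m → ‖z m‖ ≤ B * Real.exp (2 * C) := by
    intro m hm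
    refine (hbd m hm).trans (mul_le_mul_of_nonneg_left (Real.exp_le_exp.2 ?_) hB)
    have : (0 : ℝ) ≤ 1 / m := by positivity
    nlinarith
  set D := B * Real.exp (2 * C) with hD
  have hD0 : 0 ≤ D := by positivity
  have htel : ∀ n : ℕ, m ≤ n → ‖z n - z m‖ ≤ 2 * C * D * (1 / m - 1 / n) := by
    intro n hn
    induction n, hn using Nat.le_induction with
    | base => simp
    | succ n hn ih =>
      have e : z (n + 1) - z m = (z (n + 1) - z n) + (z n - z m) := by ring
      rw [e]
      refine (norm_add_le _ _).trans ?_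
      have h3 : ‖z (n + 1) - z n‖ ≤ 2 * C * (1 / n - 1 / (n + 1 : ℕ)) * D :=
        (h n (hm.trans hn)).trans (mul_le_mul (hstep n (hm.trans hn)) (hbd' n (hm.trans hn))
          (norm_nonneg _) ((by positivity : 0 ≤ C / (n : ℝ) ^ 2).trans (hstep n (hm.trans hn))))
      linarith
  have hlim : Tendsto (fun n => ‖z n - z m‖) atTop (𝓝 ‖1 - z m‖) := (hz.sub_const _).norm
  rw [norm_sub_rev]
  refine le_of_tendsto hlim ?_
  filter_upwards [eventually_ge_atTop m] with n hn
  refine (htel n hn).trans ?_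
  rw [div_eq_mul_one_div (2 * C * D)]
  have : (0 : ℝ) ≤ 1 / n := by positivity
  have h4 : 0 ≤ 2 * C * D := by positivity
  nlinarith

/-- The first-order terms of (1 + vx)(1 + x)^(-v) cancel. With x = 1/m this is the ratio of
consecutive values of `gammaRatio`, so the O(x²) error is summable. -/
theorem norm_one_add_mul_exp_sub_one_le {v : ℂ} {ρ x : ℝ} (hv : ‖v‖ ≤ ρ) (hx0 : 0 ≤ x)
    (hx1 : x ≤ 1) :
    ‖(1 + v * x) * Complex.exp (-(v * Real.log (1 + x))) - 1‖ ≤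
      Real.exp ρ * (ρ + ρ ^ 2 * Real.exp ρ) * x ^ 2 := by
  have hρ : 0 ≤ ρ := (norm_nonneg _).trans hv
  have hl0 : 0 ≤ Real.log (1 + x) := Real.log_nonneg (by linarith)
  have hl1 : Real.log (1 + x) ≤ x := by
    linarith [Real.log_le_sub_one_of_pos (show 0 < 1 + x by linarith)]
  have hl2 : x - Real.log (1 + x) ≤ x ^ 2 := by
    have := Real.one_sub_inv_le_log_of_pos (show 0 < 1 + x by linarith)
    have h2 : 1 - (1 + x)⁻¹ = x - x ^ 2 / (1 + x) := by field_simp; ring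
    have h3 : x ^ 2 / (1 + x) ≤ x ^ 2 := div_le_self (by positivity) (by linarith)
    linarith
  set y : ℂ := v * Real.log (1 + x) with hy
  have hyn : ‖y‖ ≤ ρ * x := by
    rw [hy, norm_mul, Complex.norm_real, Real.norm_of_nonneg hl0]
    gcongr
  have hyρ : ‖y‖ ≤ ρ := hyn.trans (by nlinarith)
  have e : (1 + v * x) * Complex.exp (-y) - 1 =
      Complex.exp (-y) * ((v * x - y) - (Complex.exp y - 1 - y)) := by
    rw [Complex.exp_neg]
    field_simp [Complex.exp_ne_zero]
    ring
  have h1 : ‖Complex.exp (-y)‖ ≤ Real.exp ρ :=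
    (Complex.norm_exp_le_exp_norm _).trans (Real.exp_le_exp.2 (by rwa [norm_neg]))
  have h2 : ‖v * x - y‖ ≤ ρ * x ^ 2 := by
    rw [hy, ← mul_sub, ← Complex.ofReal_sub, norm_mul, Complex.norm_real,
      Real.norm_of_nonneg (by linarith)]
    gcongr
  have h3 : ‖Complex.exp y - 1 - y‖ ≤ (ρ * x) ^ 2 * Real.exp ρ := by
    have := Complex.norm_exp_sub_sum_le_norm_mul_exp y 2
    simp only [Finset.sum_range_succ, Finset.sum_range_zero, zero_add, pow_zero, Nat.factorial_zero,
      Nat.cast_one, div_one, pow_one, Nat.factorial_one, ← sub_sub] at this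
    refine this.trans ?_
    gcongr
  rw [e, norm_mul]
  calc _ ≤ Real.exp ρ * (ρ * x ^ 2 + (ρ * x) ^ 2 * Real.exp ρ) := by
        gcongr
        exact (norm_sub_le _ _).trans (add_le_add h2 h3)
    _ = _ := by ring

/-- The ratio `Γ(v + m) / (m! m ^ (v - 1))`. -/
noncomputable def gammaRatio (m : ℕ) (v : ℂ) : ℂ :=
  Complex.Gamma v * (∏ i ∈ Finset.range m, (v + i)) / m.factorial * (m : ℂ) ^ (1 - v)

theorem gammaRatio_succ {m : ℕ} (hm : 1 ≤ m) (v : ℂ) :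
    gammaRatio (m + 1) v = gammaRatio m v *
      ((1 + v * (1 / m : ℝ)) * Complex.exp (-(v * Real.log (1 + 1 / m)))) := by
  have hm0 : (m : ℂ) ≠ 0 := by exact_mod_cast (by omega : m ≠ 0)
  have hm1 : (m : ℂ) + 1 ≠ 0 := by exact_mod_cast (by omega : m + 1 ≠ 0)
  have hmr : (0 : ℝ) < m := by exact_mod_cast hm
  have hlog : Real.log (1 + 1 / m) = Real.log (m + 1) - Real.log m := by
    rw [← Real.log_div (by positivity) (by positivity)]
    congr 1
    field_simp
  have hpow : ((m + 1 : ℕ) : ℂ) ^ (1 - v) = (m : ℂ) ^ (1 - v) * ((m + 1) / m) *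
      Complex.exp (-(v * Real.log (1 + 1 / m))) := by
    have e1 : (m : ℂ) = Complex.exp (Real.log m) := by
      rw [← Complex.ofReal_exp, Real.exp_log hmr]; simp
    have e2 : (m : ℂ) + 1 = Complex.exp (Real.log (m + 1)) := by
      rw [← Complex.ofReal_exp, Real.exp_log (by positivity)]; simp
    have l1 : Complex.log m = Real.log m := by
      rw [Complex.ofReal_log hmr.le]; simp
    have l2 : Complex.log (m + 1) = Real.log (m + 1) := by
      rw [Complex.ofReal_log (by positivity)]; simp
    push_cast
    rw [Complex.cpow_def_of_ne_zero hm1, Complex.cpow_def_of_ne_zero hm0, l1, l2]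
    have e3 : ((m : ℂ) + 1) / m = Complex.exp (Real.log (m + 1) - Real.log m) := by
      rw [Complex.exp_sub, ← e2, ← e1]
    rw [e3, ← Complex.exp_add, ← Complex.exp_add, hlog]
    congr 1
    push_cast
    ring
  rw [gammaRatio, gammaRatio, hpow, Finset.prod_range_succ, Nat.factorial_succ]
  have hf : (m.factorial : ℂ) ≠ 0 := Nat.cast_ne_zero.2 m.factorial_ne_zero
  push_cast
  field_simp
  ring

/-- Euler's limit formula: `gammaRatio m v` is Γ(v) divided by the m-th term of Euler's sequence and
by 1 + v/m. -/
theorem tendsto_gammaRatio {v : ℂ} (hv : ∀ k : ℕ, v ≠ -(k : ℂ)) :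
    Tendsto (fun m => gammaRatio m v) atTop (𝓝 1) := by
  have hG := Complex.Gamma_ne_zero hv
  have h1 := ((tendsto_const_nhds (x := Complex.Gamma v)).div
    (Complex.GammaSeq_tendsto_Gamma v) hG)
  have h2 : Tendsto (fun m : ℕ => 1 + v * ((m : ℂ))⁻¹) atTop (𝓝 1) := by
    simpa using tendsto_const_nhds.add ((tendsto_inv_atTop_nhds_zero_nat (𝕜 := ℂ)).const_mul v)
  have h3 := h1.div h2 one_ne_zero
  rw [div_self hG, div_one] at h3
  refine h3.congr' ?_
  filter_upwards [eventually_ge_atTop 1] with m hm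
  have hm0 : (m : ℂ) ≠ 0 := by exact_mod_cast (by omega : m ≠ 0)
  have hvm : ∀ k : ℕ, v + k ≠ 0 := fun k h => hv k (eq_neg_of_add_eq_zero_left h)
  have hP : ∏ i ∈ Finset.range m, (v + i) ≠ 0 := Finset.prod_ne_zero_iff.2 fun i _ => hvm i
  have hf : (m.factorial : ℂ) ≠ 0 := Nat.cast_ne_zero.2 m.factorial_ne_zero
  have hc : (m : ℂ) ^ v ≠ 0 := by simp [Complex.cpow_eq_zero_iff, hm0]
  have h4 : 1 + v * (m : ℂ)⁻¹ = (v + m) / m := by field_simp; ring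
  simp only [Pi.div_apply]
  rw [gammaRatio, Complex.GammaSeq, Finset.prod_range_succ, h4, Complex.cpow_sub _ _ hm0,
    Complex.cpow_one]
  have := hvm m
  field_simp

theorem gammaRatio_ne_zero {m : ℕ} (hm : 1 ≤ m) {v : ℂ} (hv : ∀ k : ℕ, v ≠ -(k : ℂ)) :
    gammaRatio m v ≠ 0 := by
  have hm0 : (m : ℂ) ≠ 0 := by exact_mod_cast (by omega : m ≠ 0)
  have hvm : ∀ k : ℕ, v + k ≠ 0 := fun k h => hv k (eq_neg_of_add_eq_zero_left h)
  refine mul_ne_zero (div_ne_zero (mul_ne_zero (Complex.Gamma_ne_zero hv)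
    (Finset.prod_ne_zero_iff.2 fun i _ => hvm i)) (Nat.cast_ne_zero.2 m.factorial_ne_zero)) ?_
  simp [Complex.cpow_eq_zero_iff, hm0]

theorem continuousOn_Gamma {K : Set ℂ} (hK : ∀ v ∈ K, ∀ k : ℕ, v ≠ -(k : ℂ)) :
    ContinuousOn Complex.Gamma K := fun v hv =>
  (Complex.differentiableAt_Gamma v (hK v hv)).continuousAt.continuousWithinAt

theorem continuousOn_gammaRatio {m : ℕ} (hm : 1 ≤ m) {K : Set ℂ}
    (hK : ∀ v ∈ K, ∀ k : ℕ, v ≠ -(k : ℂ)) : ContinuousOn (gammaRatio m) K := by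
  have hm0 : (m : ℂ) ≠ 0 := by exact_mod_cast (by omega : m ≠ 0)
  refine ((continuousOn_Gamma hK).mul (by fun_prop)).div_const _ |>.mul ?_
  exact (Continuous.const_cpow (by fun_prop) (Or.inl hm0)).continuousOn

/-- The rate given by `norm_sub_one_le_of_ratio` depends on `v` only through bounds for ‖v‖ and for
the first term, both available on a compact set; pointwise convergence then suffices. -/
theorem exists_norm_gammaRatio_sub_one_le {K : Set ℂ} (hKc : IsCompact K)
    (hK : ∀ v ∈ K, ∀ k : ℕ, v ≠ -(k : ℂ)) :
    ∃ C : ℝ, 0 ≤ C ∧ ∀ m : ℕ, 1 ≤ m → ∀ v ∈ K, ‖gammaRatio m v - 1‖ ≤ C / m := by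
  obtain ⟨ρ, hρ0, hρ⟩ := hKc.isBounded.exists_pos_norm_le
  obtain ⟨B, hB⟩ := hKc.exists_bound_of_continuousOn (continuousOn_gammaRatio le_rfl hK)
  set C := Real.exp ρ * (ρ + ρ ^ 2 * Real.exp ρ) with hC
  have hC0 : 0 ≤ C := by positivity
  refine ⟨2 * C * (|B| * Real.exp (2 * C)), by positivity, fun m hm v hv => ?_⟩
  refine norm_sub_one_le_of_ratio hC0 (tendsto_gammaRatio (hK v hv))
    ((hB v hv).trans (le_abs_self _)) (fun m hm => ?_) m hm
  have hm' : (1 : ℝ) ≤ m := by exact_mod_cast hm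
  rw [gammaRatio_succ hm, ← mul_sub_one, norm_mul, mul_comm]
  gcongr
  refine (norm_one_add_mul_exp_sub_one_le (hρ v hv) (by positivity)
    ((div_le_one (by linarith)).2 hm')).trans_eq ?_
  rw [hC]
  field_simp

/-- Positive lower bounds for each index, and for all large indices, give a common one. -/
theorem exists_pos_forall_le {α : Type*} {F : ℕ → α → ℝ} {K : Set α}
    (h : ∀ n, 1 ≤ n → ∃ c, 0 < c ∧ ∀ v ∈ K, c ≤ F n v) {N : ℕ} {c : ℝ} (hc : 0 < c)
    (hN : ∀ n, N ≤ n → ∀ v ∈ K, c ≤ F n v) :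
    ∃ c, 0 < c ∧ ∀ n, 1 ≤ n → ∀ v ∈ K, c ≤ F n v := by
  have key : ∀ N : ℕ, ∃ c, 0 < c ∧ ∀ n, 1 ≤ n → n < N → ∀ v ∈ K, c ≤ F n v := by
    intro N
    induction N with
    | zero => exact ⟨1, one_pos, fun n _ h => absurd h (Nat.not_lt_zero _)⟩
    | succ N ih =>
      obtain ⟨c, hc, hcN⟩ := ih
      rcases Nat.eq_zero_or_pos N with rfl | hpos
      · exact ⟨1, one_pos, fun n h1 h2 => by omega⟩
      · obtain ⟨d, hd, hdN⟩ := h N hpos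
        refine ⟨min c d, lt_min hc hd, fun n h1 h2 v hv => ?_⟩
        rcases (Nat.lt_succ_iff.1 h2).lt_or_eq with h3 | rfl
        · exact (min_le_left _ _).trans (hcN n h1 h3 v hv)
        · exact (min_le_right _ _).trans (hdN v hv)
  obtain ⟨d, hd, hdN⟩ := key N
  refine ⟨min c d, lt_min hc hd, fun n hn v hv => ?_⟩
  rcases lt_or_ge n N with h3 | h3
  · exact (min_le_right _ _).trans (hdN n hn h3 v hv)
  · exact (min_le_left _ _).trans (hN n h3 v hv)

/-- For n > 2C the distance to 1 is at most 1/2; the finitely many other indices are covered by `h`.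
-/
theorem exists_pos_le_norm_of_norm_sub_one_le {α : Type*} {F : ℕ → α → ℂ} {K : Set α} {C : ℝ}
    (h : ∀ n, 1 ≤ n → ∃ c, 0 < c ∧ ∀ v ∈ K, c ≤ ‖F n v‖)
    (hF : ∀ n : ℕ, 1 ≤ n → ∀ v ∈ K, ‖F n v - 1‖ ≤ C / n) :
    ∃ c, 0 < c ∧ ∀ n, 1 ≤ n → ∀ v ∈ K, c ≤ ‖F n v‖ := by
  obtain ⟨N, hN⟩ := exists_nat_ge (2 * C)
  refine exists_pos_forall_le h (N := N + 1) (c := 1 / 2) (by norm_num) fun n hn v hv => ?_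
  have h1 := hF n (by omega) v hv
  have hn0 : (0 : ℝ) < n := by exact_mod_cast (by omega : 0 < n)
  have hn1 : (N : ℝ) + 1 ≤ n := by exact_mod_cast hn
  have h2 : C / n ≤ 1 / 2 := by rw [div_le_iff₀ hn0]; linarith
  have h3 : ‖(1 : ℂ)‖ ≤ ‖F n v‖ + ‖F n v - 1‖ := by
    rw [show (1 : ℂ) = F n v - (F n v - 1) by ring]
    simpa using norm_sub_le (F n v) (F n v - 1)
  rw [norm_one] at h3
  linarith

theorem exists_pos_le_norm_gammaRatio {K : Set ℂ} (hKc : IsCompact K)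
    (hK : ∀ v ∈ K, ∀ k : ℕ, v ≠ -(k : ℂ)) :
    ∃ c : ℝ, 0 < c ∧ ∀ m : ℕ, 1 ≤ m → ∀ v ∈ K, c ≤ ‖gammaRatio m v‖ := by
  obtain ⟨C, -, hC⟩ := exists_norm_gammaRatio_sub_one_le hKc hK
  refine exists_pos_le_norm_of_norm_sub_one_le (fun m hm => ?_) hC
  exact hKc.exists_forall_le' (continuousOn_gammaRatio hm hK).norm fun v hv =>
    norm_pos_iff.2 (gammaRatio_ne_zero hm (hK v hv))

/-! ### Superexponential growth: convolutions and inversion of the recursion -/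

/-- The number `1 * 3 * ⋯ * (2 * n - 1)` of perfect matchings of `2 * n` points. -/
noncomputable def matchings (n : ℕ) : ℝ := ∏ i ∈ Finset.range n, (2 * i + 1 : ℝ)

theorem matchings_succ (n : ℕ) : matchings (n + 1) = matchings n * (2 * n + 1) :=
  Finset.prod_range_succ _ _

theorem matchings_pos (n : ℕ) : 0 < matchings n := Finset.prod_pos fun _ _ => by positivity

theorem matchings_mul (n : ℕ) : matchings n * (2 ^ n * n.factorial) = (2 * n).factorial := by
  induction n with
  | zero => simp [matchings]
  | succ n ih =>
    rw [show 2 * (n + 1) = 2 * n + 1 + 1 by ring, Nat.factorial_succ, Nat.factorial_succ,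
      matchings_succ, Nat.factorial_succ]
    push_cast
    rw [← ih]
    ring

/-- Induction on `k`, with equality at k = 1 in the sharper form `key`. A step multiplies the left
side by 2k + 1 and the right side by (2(k + l) + 1)/2, which is at least as large when k + 1 ≤ l. -/
theorem matchings_mul_matchings_le {k l : ℕ} (hk : 1 ≤ k) (hkl : k ≤ l) :
    matchings k * matchings l ≤ matchings (k + l) * (2 * (1 / 2) ^ k) / (k + l : ℕ) := by
  have key : matchings k * matchings l * (2 * l + 1) ≤ matchings (k + l) * (2 * (1 / 2) ^ k) := by
    induction k, hk using Nat.le_induction with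
    | base => rw [add_comm 1 l, matchings_succ l]; simp [matchings]
    | succ k hk ih =>
      have ih := ih (by omega)
      have hkl' : (k : ℝ) + 1 ≤ l := by exact_mod_cast hkl
      rw [show k + 1 + l = k + l + 1 by ring, matchings_succ, matchings_succ]
      have h1 : (2 * (k : ℝ) + 1) * (matchings (k + l) * (2 * (1 / 2) ^ k)) ≤
          (2 * (k + l : ℕ) + 1) / 2 * (matchings (k + l) * (2 * (1 / 2) ^ k)) := by
        refine mul_le_mul_of_nonneg_right ?_ (mul_nonneg (matchings_pos _).le (by positivity))
        push_cast
        linarith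
      have h2 := mul_le_mul_of_nonneg_left ih (show 0 ≤ 2 * (k : ℝ) + 1 by positivity)
      calc _ = (2 * (k : ℝ) + 1) * (matchings k * matchings l * (2 * l + 1)) := by ring
        _ ≤ _ := h2.trans h1
        _ = _ := by rw [pow_succ]; ring
  have hkl' : (k : ℝ) ≤ l := by exact_mod_cast hkl
  have hk' : (1 : ℝ) ≤ k := by exact_mod_cast hk
  push_cast
  rw [le_div_iff₀ (by linarith)]
  refine le_trans ?_ key
  exact mul_le_mul_of_nonneg_left (by linarith)
    (mul_nonneg (matchings_pos _).le (matchings_pos _).le)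

theorem summable_rpow_mul_half_pow (s : ℝ) :
    Summable fun k : ℕ => (k : ℝ) ^ s * (2 * (1 / 2) ^ k) := by
  obtain ⟨N, hN⟩ := exists_nat_ge s
  have h := (summable_pow_mul_geometric_of_norm_lt_one N
    (show ‖(1 / 2 : ℝ)‖ < 1 by norm_num)).mul_left 2
  refine Summable.of_norm_bounded_eventually_nat h ?_
  filter_upwards [eventually_ge_atTop 1] with k hk
  have hk' : (1 : ℝ) ≤ k := by exact_mod_cast hk
  rw [Real.norm_of_nonneg (by positivity)]
  have : (k : ℝ) ^ s ≤ (k : ℝ) ^ N := by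
    rw [← Real.rpow_natCast]
    exact Real.rpow_le_rpow_of_exponent_le hk' hN
  calc _ ≤ (k : ℝ) ^ N * (2 * (1 / 2) ^ k) := by gcongr
    _ = _ := by ring

/-- Used for the larger index `l` of a pair with k + l = n: since n/2 ≤ l ≤ n, the powers of `l` and
`n` are comparable for either sign of the exponent. -/
theorem rpow_le_two_rpow_mul {s t x y : ℝ} (ht : |t| ≤ s) (hx : 0 < x) (hxy : x ≤ y)
    (hyx : y ≤ 2 * x) : x ^ t ≤ 2 ^ s * y ^ t := by
  have hs : 0 ≤ s := (abs_nonneg t).trans ht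
  have hy : 0 < y := hx.trans_le hxy
  have h1 : (1 : ℝ) ≤ 2 ^ s := Real.one_le_rpow (by norm_num) hs
  rcases le_total 0 t with h | h
  · have := Real.rpow_le_rpow hx.le hxy h
    have h2 : 0 ≤ y ^ t := by positivity
    nlinarith
  · have h2 : (2 * x) ^ t ≤ y ^ t := Real.rpow_le_rpow_of_nonpos hy hyx h
    rw [Real.mul_rpow (by norm_num) hx.le] at h2
    have h3 : (1 : ℝ) ≤ 2 ^ s * 2 ^ t := by
      rw [← Real.rpow_add (by norm_num)]
      exact Real.one_le_rpow (by norm_num) (by linarith [neg_abs_le t])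
    have h4 : (0 : ℝ) < 2 ^ s := by positivity
    have h5 : 0 < x ^ t := by positivity
    calc x ^ t ≤ (2 ^ s * 2 ^ t) * x ^ t := by nlinarith
      _ = 2 ^ s * (2 ^ t * x ^ t) := by ring
      _ ≤ _ := by gcongr

/-- The convolution square of a sequence of superexponential growth is dominated by its extreme
terms. -/
theorem exists_convolution_le (s : ℝ) {c C : ℝ} (hc : 0 < c) (hC : 0 < C) :
    ∃ D : ℝ, 0 ≤ D ∧ ∀ (w : ℕ → ℝ) (t : ℝ), |t| ≤ s →
      (∀ k : ℕ, 1 ≤ k → c * (k : ℝ) ^ t ≤ w k) → (∀ k : ℕ, 1 ≤ k → w k ≤ C * (k : ℝ) ^ t) →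
      ∀ n : ℕ, ∑ k ∈ Finset.Ico 1 n, matchings k * w k * (matchings (n - k) * w (n - k)) ≤
        D * (matchings n * w n) / n := by
  set g : ℕ → ℝ := fun k => (k : ℝ) ^ s * (2 * (1 / 2) ^ k) with hg
  have hgs : Summable g := summable_rpow_mul_half_pow s
  have hg0 : ∀ k, 0 ≤ g k := fun k => by positivity
  have hG : 0 ≤ ∑' k, g k := tsum_nonneg hg0
  -- One `C` bounds `w k` for the smaller index; C · 2^s / c converts `w l` for the larger index
  -- into `w n`. The constants depend only on `s`, `c`, `C`, so the result is uniform in `w` and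
  -- `t`.
  set E : ℝ := C * C * 2 ^ s / c with hE
  have hE0 : 0 < E := by positivity
  refine ⟨E * (2 * ∑' k, g k), by positivity, fun w t ht hlow hup n => ?_⟩
  have hw0 : ∀ k, 1 ≤ k → 0 < w k := fun k hk => by
    have : (0 : ℝ) < k := by exact_mod_cast hk
    exact (by positivity : 0 < c * (k : ℝ) ^ t).trans_le (hlow k hk)
  rcases Nat.eq_zero_or_pos n with rfl | hn
  · simp
  set Q : ℝ := E * (matchings n * w n) / n with hQ
  have hQ0 : 0 ≤ Q := by
    have := matchings_pos n; have := hw0 n hn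
    positivity
  have hterm : ∀ k l : ℕ, 1 ≤ k → k ≤ l → k + l = n →
      matchings k * w k * (matchings l * w l) ≤ Q * g k := by
    intro k l hk hkl hkn
    have hkr : (1 : ℝ) ≤ k := by exact_mod_cast hk
    have hlr : (0 : ℝ) < l := by exact_mod_cast (by omega : 0 < l)
    have hnr : (0 : ℝ) < n := by exact_mod_cast hn
    have h1 := matchings_mul_matchings_le hk hkl
    rw [hkn] at h1
    have h2 : w k ≤ C * (k : ℝ) ^ s := (hup k hk).trans <| by
      gcongr
      exact (le_abs_self t).trans ht
    have h3 : w l ≤ C * 2 ^ s / c * w n := by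
      have h4 : (l : ℝ) ^ t ≤ 2 ^ s * (n : ℝ) ^ t :=
        rpow_le_two_rpow_mul ht hlr (by exact_mod_cast (by omega : l ≤ n))
          (by exact_mod_cast (by omega : n ≤ 2 * l))
      calc w l ≤ C * (l : ℝ) ^ t := hup l (by omega)
        _ ≤ C * (2 ^ s * (n : ℝ) ^ t) := by gcongr
        _ = C * 2 ^ s / c * (c * (n : ℝ) ^ t) := by field_simp
        _ ≤ _ := by gcongr; exact hlow n hn
    have hk0 := hw0 k hk
    have hl0 := hw0 l (by omega)
    have hm := matchings_pos n
    calc matchings k * w k * (matchings l * w l) = matchings k * matchings l * (w k * w l) := by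
          ring
      _ ≤ matchings n * (2 * (1 / 2) ^ k) / n * ((C * (k : ℝ) ^ s) * (C * 2 ^ s / c * w n)) := by
          gcongr
      _ = Q * g k := by rw [hQ, hE, hg]; field_simp
  -- Adding both bounds removes the need to split the sum according to which index is smaller.
  have hterm' : ∀ k ∈ Finset.Ico 1 n, matchings k * w k * (matchings (n - k) * w (n - k)) ≤
      Q * g k + Q * g (n - k) := by
    intro k hk
    obtain ⟨hk1, hk2⟩ := Finset.mem_Ico.1 hk
    have p1 := mul_nonneg hQ0 (hg0 k)
    have p2 := mul_nonneg hQ0 (hg0 (n - k))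
    rcases le_total k (n - k) with h | h
    · linarith [hterm k (n - k) hk1 h (by omega)]
    · rw [mul_comm (matchings k * w k)]
      linarith [hterm (n - k) k (by omega) h (by omega)]
  refine (Finset.sum_le_sum hterm').trans ?_
  rw [Finset.sum_add_distrib, ← Finset.mul_sum, ← Finset.mul_sum]
  have s1 : ∑ k ∈ Finset.Ico 1 n, g k ≤ ∑' k, g k := hgs.sum_le_tsum _ fun k _ => hg0 k
  have s2 : ∑ k ∈ Finset.Ico 1 n, g (n - k) ≤ ∑' k, g k := by
    have := Finset.sum_Ico_reflect g 1 (m := n) (n := n) (by omega)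
    rw [this]
    exact hgs.sum_le_tsum _ fun k _ => hg0 k
  calc _ ≤ Q * (∑' k, g k) + Q * (∑' k, g k) := by gcongr
    _ = _ := by rw [hQ]; ring

/-- A sequence defined by inverting a power series of superexponential growth. -/
theorem exists_norm_sub_two_mul_le {D : ℝ} (hD : 0 ≤ D) :
    ∃ E : ℝ, 0 ≤ E ∧ ∀ A M : ℕ → ℂ, M 0 = 0 → A 0 = 1 →
      (∀ n : ℕ, 2 * n * A n = ∑ k ∈ Finset.range (n + 1), M k * A (n - k)) →
      (∀ n : ℕ, ∑ k ∈ Finset.Ico 1 n, ‖A k‖ * ‖A (n - k)‖ ≤ D * ‖A n‖ / n) →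
      ∀ n : ℕ, 1 ≤ n → ‖M n - 2 * n * A n‖ ≤ E * ‖A n‖ := by
  -- With B = 4(1 + D)^N, the bound ‖M k‖ ≤ B k ‖A k‖ reproduces itself beyond `N`: 2n ≤ Bn/2
  -- because B ≥ 4, and BD ≤ Bn/2 because n ≥ 2D. Up to `N` a cruder bound, losing a factor 1 + D
  -- per step, is enough.
  obtain ⟨N, hN⟩ := exists_nat_ge (2 * D)
  refine ⟨4 * (1 + D) ^ N * D, by positivity, fun A M hM0 hA0 hrec hconv => ?_⟩
  -- The end terms of the recursion are isolated: k = 0 vanishes since M 0 = 0, and k = n is `M n`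
  -- since A 0 = 1.
  have hsum : ∀ n : ℕ, 1 ≤ n → M n - 2 * n * A n = -∑ k ∈ Finset.Ico 1 n, M k * A (n - k) := by
    intro n hn
    rw [hrec, Finset.sum_range_succ, Finset.range_eq_Ico, Finset.sum_eq_sum_Ico_succ_bot (by omega),
      hM0, Nat.sub_self, hA0]
    ring
  have hbound : ∀ (n : ℕ) (B : ℝ), 1 ≤ n → 0 ≤ B →
      (∀ k ∈ Finset.Ico 1 n, ‖M k‖ ≤ B * k * ‖A k‖) → ‖M n - 2 * n * A n‖ ≤ B * D * ‖A n‖ := by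
    intro n B hn hB h
    have hn' : (0 : ℝ) < n := by exact_mod_cast hn
    rw [hsum n hn, norm_neg]
    calc ‖∑ k ∈ Finset.Ico 1 n, M k * A (n - k)‖
        ≤ ∑ k ∈ Finset.Ico 1 n, B * n * (‖A k‖ * ‖A (n - k)‖) := by
          refine norm_sum_le_of_le _ fun k hk => ?_
          have hkn : (k : ℝ) ≤ n := by exact_mod_cast (Finset.mem_Ico.1 hk).2.le
          rw [norm_mul]
          calc ‖M k‖ * ‖A (n - k)‖ ≤ B * k * ‖A k‖ * ‖A (n - k)‖ := by gcongr; exact h k hk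
            _ ≤ B * n * ‖A k‖ * ‖A (n - k)‖ := by gcongr
            _ = _ := by ring
      _ = B * n * ∑ k ∈ Finset.Ico 1 n, ‖A k‖ * ‖A (n - k)‖ := by rw [Finset.mul_sum]
      _ ≤ B * n * (D * ‖A n‖ / n) := by gcongr; exact hconv n
      _ = _ := by field_simp
  have hnorm : ∀ (n : ℕ) (x : ℝ), ‖M n - 2 * n * A n‖ ≤ x * ‖A n‖ →
      ‖M n‖ ≤ (2 * n + x) * ‖A n‖ := by
    intro n x h
    have h1 : ‖M n‖ ≤ ‖M n - 2 * n * A n‖ + ‖2 * n * A n‖ := by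
      simpa using norm_add_le (M n - 2 * n * A n) (2 * n * A n)
    have h2 : ‖2 * (n : ℂ) * A n‖ = 2 * n * ‖A n‖ := by simp
    rw [h2] at h1
    linarith
  have hsmall : ∀ n : ℕ, 1 ≤ n → ‖M n‖ ≤ 4 * (1 + D) ^ n * n * ‖A n‖ := by
    intro n
    induction n using Nat.strong_induction_on with
    | _ n ih =>
      intro hn
      obtain ⟨m, rfl⟩ : ∃ m, n = m + 1 := ⟨n - 1, by omega⟩
      have h1 := hbound (m + 1) (4 * (1 + D) ^ m) hn (by positivity) fun k hk => by
        obtain ⟨hk1, hk2⟩ := Finset.mem_Ico.1 hk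
        refine (ih k hk2 hk1).trans ?_
        gcongr
        · linarith
        · omega
      refine (hnorm _ _ h1).trans ?_
      have h3 : (1 : ℝ) ≤ (1 + D) ^ m := one_le_pow₀ (by linarith)
      have h4 : (1 : ℝ) ≤ (m + 1 : ℕ) := by exact_mod_cast hn
      have h5 : 0 ≤ (1 + D) ^ m * D := by positivity
      rw [pow_succ]
      gcongr
      nlinarith
  have hlarge : ∀ n : ℕ, 1 ≤ n → ‖M n‖ ≤ 4 * (1 + D) ^ N * n * ‖A n‖ := by
    intro n
    induction n using Nat.strong_induction_on with
    | _ n ih =>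
      intro hn
      rcases le_or_gt n N with h | h
      · refine (hsmall n hn).trans ?_
        gcongr
        linarith
      · have h1 := hbound n (4 * (1 + D) ^ N) hn (by positivity) fun k hk => by
          obtain ⟨hk1, hk2⟩ := Finset.mem_Ico.1 hk
          exact ih k hk2 hk1
        refine (hnorm _ _ h1).trans ?_
        have h3 : (1 : ℝ) ≤ (1 + D) ^ N := one_le_pow₀ (by linarith)
        have h4 : 2 * D ≤ n := hN.trans (by exact_mod_cast h.le)
        have h5 : (0 : ℝ) ≤ n := by positivity
        gcongr
        nlinarith [mul_nonneg (by linarith : (0 : ℝ) ≤ (1 + D) ^ N) (by linarith : 0 ≤ n - 2 * D),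
          mul_nonneg h5 (by linarith : 0 ≤ (1 + D) ^ N - 1)]
  intro n hn
  exact hbound n _ hn (by positivity) fun k hk => hlarge k (Finset.mem_Ico.1 hk).1

/-! ### Asymptotics of the generating coefficients -/

namespace HalfEdgeMap

theorem allCoeff_zero (v : ℂ) : allCoeff 0 v = 1 := by simp [allCoeff]

theorem rootedCoeff_zero (v : ℂ) : rootedCoeff 0 v = 0 := by simp [rootedCoeff]

/-- Separates the superexponential factor, which does not depend on `v`, from a factor of polynomial
growth. -/
theorem allCoeff_eq (n : ℕ) (v : ℂ) :
    allCoeff n v = matchings n * ((∏ i ∈ Finset.range (2 * n), (v + i)) / (2 * n).factorial) := by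
  have h := congrArg (fun x : ℝ => (x : ℂ)) (matchings_mul n)
  have h1 : (n.factorial : ℂ) ≠ 0 := Nat.cast_ne_zero.2 (Nat.factorial_ne_zero _)
  have h2 : ((2 * n).factorial : ℂ) ≠ 0 := Nat.cast_ne_zero.2 (Nat.factorial_ne_zero _)
  push_cast at h
  rw [allCoeff, div_eq_iff (mul_ne_zero (by simp) h1), mul_div_assoc', div_mul_eq_mul_div,
    eq_div_iff h2, ← h]
  ring

theorem allCoeff_one (n : ℕ) : allCoeff n 1 = matchings n := by
  have h2 : ((2 * n).factorial : ℂ) ≠ 0 := Nat.cast_ne_zero.2 (Nat.factorial_ne_zero _)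
  have : ∏ i ∈ Finset.range (2 * n), (1 + i : ℂ) = (2 * n).factorial := by
    rw [← Finset.prod_range_add_one_eq_factorial]
    push_cast
    exact Finset.prod_congr rfl fun i _ => add_comm _ _
  rw [allCoeff_eq, this, div_self h2, mul_one]

theorem allCoeff_eq_gammaRatio {n : ℕ} (hn : 1 ≤ n) {v : ℂ} (hv : ∀ k : ℕ, v ≠ -(k : ℂ)) :
    allCoeff n v = matchings n * (gammaRatio (2 * n) v *
      (2 ^ (v - 1) / Complex.Gamma v * (n : ℂ) ^ (v - 1))) := by
  have hG := Complex.Gamma_ne_zero hv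
  have h2n : ((2 * n : ℕ) : ℂ) ≠ 0 := by exact_mod_cast (by omega : 2 * n ≠ 0)
  have h2 : ((2 * n).factorial : ℂ) ≠ 0 := Nat.cast_ne_zero.2 (Nat.factorial_ne_zero _)
  have hp : ((2 * n : ℕ) : ℂ) ^ (v - 1) = 2 ^ (v - 1) * (n : ℂ) ^ (v - 1) := by
    have := Complex.natCast_mul_natCast_cpow 2 n (v - 1)
    exact_mod_cast this
  have hq : ((2 * n : ℕ) : ℂ) ^ (1 - v) * ((2 * n : ℕ) : ℂ) ^ (v - 1) = 1 := by
    rw [← Complex.cpow_add _ _ h2n]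
    simp
  rw [allCoeff_eq, gammaRatio]
  congr 1
  rw [div_mul_eq_mul_div (2 ^ (v - 1)), ← hp]
  generalize ((2 * n : ℕ) : ℂ) ^ (v - 1) = y at *
  generalize ((2 * n : ℕ) : ℂ) ^ (1 - v) = x at *
  field_simp
  linear_combination -(∏ i ∈ Finset.range (2 * n), (v + i)) * hq

theorem norm_allCoeff {n : ℕ} (hn : 1 ≤ n) {v : ℂ} (hv : ∀ k : ℕ, v ≠ -(k : ℂ)) :
    ‖allCoeff n v‖ = matchings n * (‖gammaRatio (2 * n) v‖ *
      ‖2 ^ (v - 1) / Complex.Gamma v‖ * (n : ℝ) ^ (v.re - 1)) := by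
  rw [allCoeff_eq_gammaRatio hn hv, norm_mul, norm_mul, norm_mul, Complex.norm_real,
    Real.norm_of_nonneg (matchings_pos n).le, Complex.norm_natCast_cpow_of_pos hn]
  simp [mul_assoc]

theorem continuousOn_leading {K : Set ℂ} (hK : ∀ v ∈ K, ∀ k : ℕ, v ≠ -(k : ℂ)) :
    ContinuousOn (fun v : ℂ => 2 ^ (v - 1) / Complex.Gamma v) K :=
  (Continuous.const_cpow (by fun_prop) (Or.inl two_ne_zero)).continuousOn.div
    (continuousOn_Gamma hK) fun v hv => Complex.Gamma_ne_zero (hK v hv)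

theorem leading_ne_zero {v : ℂ} (hv : ∀ k : ℕ, v ≠ -(k : ℂ)) :
    2 ^ (v - 1) / Complex.Gamma v ≠ 0 :=
  div_ne_zero (by simp [Complex.cpow_eq_zero_iff]) (Complex.Gamma_ne_zero hv)

theorem allCoeff_ne_zero (n : ℕ) {v : ℂ} (hv : ∀ k : ℕ, v ≠ -(k : ℂ)) : allCoeff n v ≠ 0 := by
  have hvm : ∀ k : ℕ, v + k ≠ 0 := fun k h => hv k (eq_neg_of_add_eq_zero_left h)
  have h1 : (n.factorial : ℂ) ≠ 0 := Nat.cast_ne_zero.2 (Nat.factorial_ne_zero _)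
  exact div_ne_zero (Finset.prod_ne_zero_iff.2 fun i _ => hvm i) (mul_ne_zero (by simp) h1)

/-- `exists_convolution_le` applies with exponent t = Re v - 1, since by compactness the remaining
factors of `norm_allCoeff` lie between positive constants. -/
theorem exists_sum_norm_allCoeff_le {K : Set ℂ} (hKc : IsCompact K)
    (hK : ∀ v ∈ K, ∀ k : ℕ, v ≠ -(k : ℂ)) :
    ∃ D : ℝ, 0 ≤ D ∧ ∀ v ∈ K, ∀ n : ℕ,
      ∑ k ∈ Finset.Ico 1 n, ‖allCoeff k v‖ * ‖allCoeff (n - k) v‖ ≤ D * ‖allCoeff n v‖ / n := by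
  obtain ⟨ρ, hρ0, hρ⟩ := hKc.isBounded.exists_pos_norm_le
  obtain ⟨c₁, hc₁, hlow⟩ := exists_pos_le_norm_gammaRatio hKc hK
  obtain ⟨C₁, hC₁, hup⟩ := exists_norm_gammaRatio_sub_one_le hKc hK
  obtain ⟨c₂, hc₂, hlow'⟩ := hKc.exists_forall_le' (continuousOn_leading hK).norm fun v hv =>
    norm_pos_iff.2 (leading_ne_zero (hK v hv))
  obtain ⟨C₂, hup'⟩ := hKc.exists_bound_of_continuousOn (continuousOn_leading hK)
  have hup1 : ∀ m : ℕ, 1 ≤ m → ∀ v ∈ K, ‖gammaRatio m v‖ ≤ 1 + C₁ := by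
    intro m hm v hv
    have h1 : ‖gammaRatio m v‖ ≤ ‖gammaRatio m v - 1‖ + ‖(1 : ℂ)‖ := by
      simpa using norm_add_le (gammaRatio m v - 1) 1
    have h2 : C₁ / m ≤ C₁ := div_le_self hC₁ (by exact_mod_cast hm)
    have h3 := hup m hm v hv
    rw [norm_one] at h1
    linarith
  obtain ⟨D, hD, h⟩ := exists_convolution_le (ρ + 1) (c := c₁ * c₂) (C := (1 + C₁) * (|C₂| + 1))
    (by positivity) (by positivity)
  refine ⟨D, hD, fun v hv n => ?_⟩
  rcases Nat.eq_zero_or_pos n with rfl | hn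
  · simp
  have ht : |v.re - 1| ≤ ρ + 1 := by
    have h1 := (Complex.abs_re_le_norm v).trans (hρ v hv)
    have h2 := abs_sub v.re 1
    rw [abs_one] at h2
    linarith
  have := h (fun k => ‖gammaRatio (2 * k) v‖ * ‖2 ^ (v - 1) / Complex.Gamma v‖ *
    (k : ℝ) ^ (v.re - 1)) (v.re - 1) ht (fun k hk => by
      gcongr
      · exact hlow _ (by omega) v hv
      · exact hlow' v hv) (fun k hk => by
      gcongr
      · exact hup1 _ (by omega) v hv
      · exact (hup' v hv).trans ((le_abs_self _).trans (by linarith))) n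
  rw [norm_allCoeff hn (hK v hv)]
  refine le_trans (le_of_eq (Finset.sum_congr rfl fun k hk => ?_)) this
  obtain ⟨hk1, hk2⟩ := Finset.mem_Ico.1 hk
  rw [norm_allCoeff hk1 (hK v hv), norm_allCoeff (by omega) (hK v hv)]

theorem exists_norm_rootedCoeff_div_sub_one_le {K : Set ℂ} (hKc : IsCompact K)
    (hK : ∀ v ∈ K, ∀ k : ℕ, v ≠ -(k : ℂ)) :
    ∃ C : ℝ, 0 ≤ C ∧ ∀ n : ℕ, 1 ≤ n → ∀ v ∈ K,
      ‖rootedCoeff n v / (2 * n * allCoeff n v) - 1‖ ≤ C / n := by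
  obtain ⟨D, hD, hconv⟩ := exists_sum_norm_allCoeff_le hKc hK
  obtain ⟨E, hE, h⟩ := exists_norm_sub_two_mul_le hD
  refine ⟨E, hE, fun n hn v hv => ?_⟩
  have h1 := h (fun n => allCoeff n v) (fun n => rootedCoeff n v) (rootedCoeff_zero v)
    (allCoeff_zero v) (fun n => two_mul_allCoeff n v) (hconv v hv) n hn
  have hA := allCoeff_ne_zero n (hK v hv)
  have hA' : 0 < ‖allCoeff n v‖ := norm_pos_iff.2 hA
  have hn0 : (n : ℂ) ≠ 0 := by exact_mod_cast (by omega : n ≠ 0)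
  have hn0' : (0 : ℝ) < n := by exact_mod_cast hn
  rw [div_sub_one (mul_ne_zero (mul_ne_zero two_ne_zero hn0) hA), norm_div, norm_mul, norm_mul,
    Complex.norm_natCast, Complex.norm_ofNat, div_le_div_iff₀ (by positivity) hn0']
  nlinarith [mul_le_mul_of_nonneg_right h1 hn0'.le, mul_nonneg (mul_nonneg hE hA'.le) hn0'.le]

end HalfEdgeMap

/-! ### The probability generating function, uniformly on compact sets -/

namespace RootedMap

theorem exists_norm_pgf_div_sub_one_le {K : Set ℂ} (hKc : IsCompact K)
    (hK : ∀ v ∈ K, ∀ k : ℕ, v ≠ -(k : ℂ)) :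
    ∃ C : ℝ, ∀ n : ℕ, 1 ≤ n → ∀ v ∈ K,
      ‖(∫ m, v ^ m.numVertices ∂(uniform n)) /
        (2 ^ (v - 1) / Complex.Gamma v * (n : ℂ) ^ (v - 1)) - 1‖ ≤ C / n := by
  have h1K : ∀ v ∈ ({1} : Set ℂ), ∀ k : ℕ, v ≠ -(k : ℂ) := by
    rintro v rfl k h
    have := congrArg Complex.re h
    simp at this
    have : (0 : ℝ) ≤ k := Nat.cast_nonneg k
    linarith
  obtain ⟨C₁, hC₁, h1⟩ := HalfEdgeMap.exists_norm_rootedCoeff_div_sub_one_le hKc hK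
  obtain ⟨C₂, hC₂, h2⟩ := exists_norm_gammaRatio_sub_one_le hKc hK
  obtain ⟨C₃, hC₃, h3⟩ := HalfEdgeMap.exists_norm_rootedCoeff_div_sub_one_le isCompact_singleton h1K
  -- The normalising factor at v = 1 gets inverted, so it must stay away from 0 for every n ≥ 1. For
  -- small `n` this uses that rooted maps exist.
  obtain ⟨c, hc, h4⟩ := exists_pos_le_norm_of_norm_sub_one_le (fun n hn =>
    ⟨‖HalfEdgeMap.rootedCoeff n 1 / (2 * n * HalfEdgeMap.allCoeff n 1)‖, norm_pos_iff.2 <| by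
      have hn0 : (n : ℂ) ≠ 0 := by exact_mod_cast (by omega : n ≠ 0)
      have := rootedCoeff_one_ne_zero (by omega : n ≠ 0)
      have := HalfEdgeMap.allCoeff_ne_zero n (h1K 1 rfl)
      exact div_ne_zero ‹_› (mul_ne_zero (mul_ne_zero two_ne_zero hn0) ‹_›), by
        rintro v rfl; exact le_rfl⟩) h3
  refine ⟨(C₁ + C₂ + C₁ * C₂) + C₃ / c + (C₁ + C₂ + C₁ * C₂) * (C₃ / c), fun n hn v hv => ?_⟩
  have hn' : (1 : ℝ) ≤ n := by exact_mod_cast hn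
  have hn0 : (n : ℂ) ≠ 0 := by exact_mod_cast (by omega : n ≠ 0)
  have hM1 := rootedCoeff_one_ne_zero (by omega : n ≠ 0)
  have hA1 := HalfEdgeMap.allCoeff_ne_zero n (h1K 1 rfl)
  have hA := HalfEdgeMap.allCoeff_ne_zero n (hK v hv)
  have b1 := h1 n hn v hv
  have b2 : ‖gammaRatio (2 * n) v - 1‖ ≤ C₂ / n := (h2 (2 * n) (by omega) v hv).trans <| by
    gcongr
    omega
  have b3 : ‖(HalfEdgeMap.rootedCoeff n 1 / (2 * n * HalfEdgeMap.allCoeff n 1))⁻¹ - 1‖ ≤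
      C₃ / c / n := by
    set y := HalfEdgeMap.rootedCoeff n 1 / (2 * n * HalfEdgeMap.allCoeff n 1) with hy
    have hyc : c ≤ ‖y‖ := h4 n hn 1 rfl
    have hy0 : y ≠ 0 := norm_pos_iff.1 (hc.trans_le hyc)
    have e : y⁻¹ - 1 = -(y - 1) / y := by field_simp; ring
    rw [e, norm_div, norm_neg, div_right_comm]
    have := h3 n hn 1 rfl
    gcongr
  have b := norm_mul_sub_one_le hn' (by positivity) (by positivity)
    (norm_mul_sub_one_le hn' hC₁ hC₂ b1 b2) b3
  refine le_of_eq_of_le ?_ b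
  have hAe := HalfEdgeMap.allCoeff_eq_gammaRatio hn (hK v hv)
  have hA1e := HalfEdgeMap.allCoeff_one n
  have hR := gammaRatio_ne_zero (show 1 ≤ 2 * n by omega) (hK v hv)
  have hg : 2 ^ (v - 1) / Complex.Gamma v * (n : ℂ) ^ (v - 1) ≠ 0 :=
    mul_ne_zero (HalfEdgeMap.leading_ne_zero (hK v hv)) (by simp [Complex.cpow_eq_zero_iff, hn0])
  have hm : (matchings n : ℂ) ≠ 0 := Complex.ofReal_ne_zero.2 (matchings_pos n).ne'
  rw [integral_pow_numVertices (by omega)]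
  generalize 2 ^ (v - 1) / Complex.Gamma v * (n : ℂ) ^ (v - 1) = g at *
  congr 2
  rw [hAe, hA1e]
  field_simp

theorem exists_norm_pgf_sub_le {K : Set ℂ} (hKc : IsCompact K)
    (hK : ∀ v ∈ K, ∀ k : ℕ, v ≠ -(k : ℂ)) :
    ∃ C : ℝ, ∀ n : ℕ, 1 ≤ n → ∀ v ∈ K,
      ‖(∫ m, v ^ m.numVertices ∂(uniform n)) -
          2 ^ (v - 1) / Complex.Gamma v * (n : ℂ) ^ (v - 1)‖ ≤
        C / n * ‖2 ^ (v - 1) / Complex.Gamma v * (n : ℂ) ^ (v - 1)‖ := by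
  obtain ⟨C, hC⟩ := exists_norm_pgf_div_sub_one_le hKc hK
  refine ⟨C, fun n hn v hv => ?_⟩
  have hn0 : (n : ℂ) ≠ 0 := by exact_mod_cast (by omega : n ≠ 0)
  have hg : 2 ^ (v - 1) / Complex.Gamma v * (n : ℂ) ^ (v - 1) ≠ 0 :=
    mul_ne_zero (HalfEdgeMap.leading_ne_zero (hK v hv)) (by simp [Complex.cpow_eq_zero_iff, hn0])
  have := hC n hn v hv
  rwa [div_sub_one hg, norm_div, div_le_iff₀ (norm_pos_iff.2 hg)] at this

end RootedMap

/-! ### Mean and variance from the derivatives at 1 -/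

namespace RootedMap

/-- The probability generating function of the number of vertices. -/
noncomputable def pgf (n : ℕ) (v : ℂ) : ℂ := ∫ m, v ^ m.numVertices ∂(uniform n)

/-- The first derivative of the probability generating function. -/
noncomputable def pgfDeriv (n : ℕ) (v : ℂ) : ℂ :=
  ∫ m, (m.numVertices : ℂ) * v ^ (m.numVertices - 1) ∂(uniform n)

/-- The second derivative of the probability generating function. -/
noncomputable def pgfDerivTwo (n : ℕ) (v : ℂ) : ℂ :=
  ∫ m, (m.numVertices : ℂ) * (((m.numVertices - 1 : ℕ) : ℂ) * v ^ (m.numVertices - 1 - 1))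
    ∂(uniform n)

theorem hasDerivAt_pgf (n : ℕ) (v : ℂ) : HasDerivAt (pgf n) (pgfDeriv n v) v := by
  have : pgf n = fun v => (Fintype.card (RootedMap n) : ℝ)⁻¹ • ∑ m : RootedMap n,
      v ^ m.numVertices := funext fun v => integral_uniform n _
  rw [this, pgfDeriv, integral_uniform]
  exact HasDerivAt.fun_const_smul (_ : ℝ) (HasDerivAt.fun_sum fun (m : RootedMap n) _ =>
    hasDerivAt_pow m.numVertices v)

theorem hasDerivAt_pgfDeriv (n : ℕ) (v : ℂ) : HasDerivAt (pgfDeriv n) (pgfDerivTwo n v) v := by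
  have : pgfDeriv n = fun v => (Fintype.card (RootedMap n) : ℝ)⁻¹ • ∑ m : RootedMap n,
      (m.numVertices : ℂ) * v ^ (m.numVertices - 1) := funext fun v => integral_uniform n _
  rw [this, pgfDerivTwo, integral_uniform]
  exact HasDerivAt.fun_const_smul (_ : ℝ) (HasDerivAt.fun_sum fun (m : RootedMap n) _ =>
    (hasDerivAt_pow (m.numVertices - 1) v).const_mul _)

theorem pgf_one (n : ℕ) : pgf n 1 = 1 := by simp [pgf]

theorem pgfDeriv_one (n : ℕ) : pgfDeriv n 1 = ((∫ m, X n m ∂(uniform n) : ℝ) : ℂ) := by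
  rw [pgfDeriv, ← integral_complex_ofReal]
  simp [X]

theorem pgfDerivTwo_one (n : ℕ) : pgfDerivTwo n 1 =
    ((Var[X n; uniform n] + (∫ m, X n m ∂(uniform n)) ^ 2 - ∫ m, X n m ∂(uniform n) : ℝ) : ℂ) := by
  rw [variance_eq_sub MemLp.of_discrete, sub_add_cancel,
    ← integral_sub Integrable.of_finite Integrable.of_finite, pgfDerivTwo,
    ← integral_complex_ofReal]
  congr 1
  ext m
  rcases Nat.eq_zero_or_pos m.numVertices with h | h
  · simp [X, h]
  · simp only [X, Pi.pow_apply, one_pow, mul_one]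
    push_cast [Nat.cast_sub h]
    ring

/-- The probability generating function divided by that of a Poisson variable of parameter
`log n`. -/
noncomputable def normalizedPgf (n : ℕ) (v : ℂ) : ℂ :=
  pgf n v * Complex.exp (-(Real.log n * (v - 1)))

theorem hasDerivAt_exp_neg_mul (L v : ℂ) :
    HasDerivAt (fun v => Complex.exp (-(L * (v - 1)))) (-(L * Complex.exp (-(L * (v - 1))))) v := by
  have h := ((((hasDerivAt_id v).sub_const 1).const_mul L).neg).cexp
  rw [show -(L * Complex.exp (-(L * (v - 1)))) = Complex.exp (-(L * (v - 1))) * -(L * 1) by ring]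
  exact h

theorem deriv_normalizedPgf (n : ℕ) (v : ℂ) : deriv (normalizedPgf n) v =
    (pgfDeriv n v - Real.log n * pgf n v) * Complex.exp (-(Real.log n * (v - 1))) := by
  have h := (hasDerivAt_pgf n v).mul (hasDerivAt_exp_neg_mul (Real.log n) v)
  rw [show normalizedPgf n = pgf n * fun v => Complex.exp (-(Real.log n * (v - 1))) from rfl,
    h.deriv]
  ring

theorem deriv_deriv_normalizedPgf_one (n : ℕ) : deriv (deriv (normalizedPgf n)) 1 =
    pgfDerivTwo n 1 - 2 * Real.log n * pgfDeriv n 1 + (Real.log n : ℂ) ^ 2 := by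
  have h := (((hasDerivAt_pgfDeriv n 1).sub ((hasDerivAt_pgf n 1).const_mul
    (Real.log n : ℂ))).mul (hasDerivAt_exp_neg_mul (Real.log n) 1))
  have e : deriv (normalizedPgf n) = fun v => (pgfDeriv n v - Real.log n * pgf n v) *
    Complex.exp (-(Real.log n * (v - 1))) := funext (deriv_normalizedPgf n)
  rw [e]
  refine h.deriv.trans ?_
  simp only [Pi.sub_apply, pgf_one, sub_self, mul_zero, neg_zero, Complex.exp_zero]
  ring

theorem differentiable_normalizedPgf (n : ℕ) : Differentiable ℂ (normalizedPgf n) := fun v =>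
  ((hasDerivAt_pgf n v).mul (hasDerivAt_exp_neg_mul (Real.log n) v)).differentiableAt

theorem isOpen_re_pos : IsOpen {v : ℂ | 0 < v.re} :=
  isOpen_lt continuous_const Complex.continuous_re

theorem ne_neg_natCast_of_re_pos {v : ℂ} (hv : 0 < v.re) (k : ℕ) : v ≠ -(k : ℂ) := by
  rintro rfl
  have : (0 : ℝ) ≤ k := Nat.cast_nonneg k
  simp at hv
  linarith

theorem natCast_cpow_eq_exp {n : ℕ} (hn : 1 ≤ n) (w : ℂ) :
    (n : ℂ) ^ w = Complex.exp (Real.log n * w) := by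
  have hn0 : (n : ℂ) ≠ 0 := by exact_mod_cast (by omega : n ≠ 0)
  rw [Complex.cpow_def_of_ne_zero hn0, Complex.ofReal_log (Nat.cast_nonneg n),
    Complex.ofReal_natCast]

/-- The exponential factor is exactly n^(1-v), so the relative error O(1/n) becomes an absolute one.
The half-plane is an open set containing 1 and avoiding the poles of Γ. -/
theorem tendstoLocallyUniformlyOn_normalizedPgf :
    TendstoLocallyUniformlyOn normalizedPgf (fun v => 2 ^ (v - 1) / Complex.Gamma v) atTop
      {v : ℂ | 0 < v.re} := by
  rw [tendstoLocallyUniformlyOn_iff_forall_isCompact isOpen_re_pos]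
  intro K hKU hKc
  have hK : ∀ v ∈ K, ∀ k : ℕ, v ≠ -(k : ℂ) := fun v hv => ne_neg_natCast_of_re_pos (hKU hv)
  obtain ⟨C, hC⟩ := exists_norm_pgf_sub_le hKc hK
  obtain ⟨B, hB⟩ := hKc.exists_bound_of_continuousOn (HalfEdgeMap.continuousOn_leading hK)
  rw [Metric.tendstoUniformlyOn_iff]
  intro ε hε
  have hlim : Tendsto (fun n : ℕ => |C| * |B| / (n : ℝ)) atTop (𝓝 0) :=
    tendsto_const_div_atTop_nhds_zero_nat _
  filter_upwards [hlim.eventually (gt_mem_nhds hε), eventually_ge_atTop 1] with n hn hn1 v hv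
  refine lt_of_le_of_lt ?_ hn
  have h := hC n hn1 v hv
  have hn0 : (0 : ℝ) < n := by exact_mod_cast hn1
  rw [natCast_cpow_eq_exp hn1] at h
  set g := 2 ^ (v - 1) / Complex.Gamma v
  set L : ℂ := (Real.log n : ℂ)
  have he : Complex.exp (L * (v - 1)) * Complex.exp (-(L * (v - 1))) = 1 := by
    rw [← Complex.exp_add, add_neg_cancel, Complex.exp_zero]
  have e : normalizedPgf n v - g =
      (pgf n v - g * Complex.exp (L * (v - 1))) * Complex.exp (-(L * (v - 1))) := by
    rw [sub_mul, mul_assoc, he, mul_one]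
    rfl
  rw [dist_comm, dist_eq_norm, e, norm_mul]
  calc _ ≤ C / n * ‖g * Complex.exp (L * (v - 1))‖ * ‖Complex.exp (-(L * (v - 1)))‖ := by
        gcongr
        exact h
    _ = C / n * ‖g‖ := by
        rw [mul_assoc, ← norm_mul, mul_assoc, he, mul_one]
    _ ≤ |C| / n * |B| := by
        gcongr
        · exact le_abs_self _
        · exact (hB v hv).trans (le_abs_self _)
    _ = _ := by ring

/-- The expected number of vertices is `log n + O(1)`. -/
theorem exists_tendsto_mean_sub_log : ∃ a : ℝ,
    Tendsto (fun n : ℕ => ∫ m, X n m ∂(uniform n) - Real.log n) atTop (𝓝 a) := by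
  -- Weierstrass: locally uniform convergence of holomorphic functions passes to derivatives, and
  -- the derivative at 1 is E(X) - log n.
  have h := (tendstoLocallyUniformlyOn_normalizedPgf.deriv (Eventually.of_forall fun n =>
    (differentiable_normalizedPgf n).differentiableOn) isOpen_re_pos).tendsto_at
      (show (1 : ℂ) ∈ {v : ℂ | 0 < v.re} by simp)
  refine ⟨_, (Complex.continuous_re.tendsto _).comp h |>.congr fun n => ?_⟩
  simp only [Function.comp_apply, deriv_normalizedPgf, pgf_one, pgfDeriv_one]
  rw [sub_self, mul_zero, neg_zero, Complex.exp_zero, mul_one, mul_one, ← Complex.ofReal_sub,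
    Complex.ofReal_re]

/-- The variance of the number of vertices is `log n + O(1)`. -/
theorem exists_tendsto_variance_sub_log : ∃ b : ℝ,
    Tendsto (fun n : ℕ => Var[X n; uniform n] - Real.log n) atTop (𝓝 b) := by
  obtain ⟨a, ha⟩ := exists_tendsto_mean_sub_log
  have h1 := tendstoLocallyUniformlyOn_normalizedPgf.deriv (Eventually.of_forall fun n =>
    (differentiable_normalizedPgf n).differentiableOn) isOpen_re_pos
  have h2 := (h1.deriv (Eventually.of_forall fun n =>
    ((differentiable_normalizedPgf n).differentiableOn (s := Set.univ)).deriv isOpen_univ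
      |>.mono (Set.subset_univ _)) isOpen_re_pos).tendsto_at
      (show (1 : ℂ) ∈ {v : ℂ | 0 < v.re} by simp)
  -- With μ the mean and L = log n, the second derivative at 1 is Var - μ + (μ - L)², so Var - L
  -- equals it plus (μ - L) - (μ - L)².
  refine ⟨_, (((Complex.continuous_re.tendsto _).comp h2).add ha).sub (ha.pow 2)
    |>.congr fun n => ?_⟩
  simp only [Function.comp_apply, deriv_deriv_normalizedPgf_one, pgfDeriv_one, pgfDerivTwo_one]
  norm_cast
  ring

/-! ### Central limit theorem by characteristic functions -/

theorem tendsto_log_natCast : Tendsto (fun n : ℕ => Real.log n) atTop atTop :=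
  Real.tendsto_log_atTop.comp tendsto_natCast_atTop_atTop

theorem isEquivalent_log_of_tendsto_sub {u : ℕ → ℝ} {a : ℝ}
    (h : Tendsto (fun n : ℕ => u n - Real.log n) atTop (𝓝 a)) :
    u ~[atTop] fun n : ℕ => Real.log n := by
  refine (h.isBigO_one ℝ).trans_isLittleO ?_
  rw [Asymptotics.isLittleO_const_left]
  exact Or.inr (tendsto_norm_atTop_atTop.comp tendsto_log_natCast)

theorem charFun_standardized (n : ℕ) (t μ σ : ℝ) :
    charFun ((uniform n).map fun m => (X n m - μ) / σ) t =
      Complex.exp (-(μ * (t / σ * Complex.I))) * pgf n (Complex.exp (t / σ * Complex.I)) := by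
  rw [charFun_apply_real, integral_map (by fun_prop) (by fun_prop), pgf, ← integral_const_mul]
  congr 1
  ext m
  rw [← Complex.exp_nat_mul, ← Complex.exp_add]
  congr 1
  simp only [X]
  push_cast
  ring

/-- With z = it/σ and L = log n, the characteristic function is `normalizedPgf` at exp z times
exp(L(exp z - 1) - μz). The exponent splits into Lz²/2, which tends to -t²/2 as L/σ² → 1, the term
-z(μ - L), which tends to 0, and a remainder O(L|z|³), which tends to 0. -/
theorem tendsto_charFun_standardized {μ σ : ℕ → ℝ} {a b : ℝ}
    (hμ : Tendsto (fun n : ℕ => μ n - Real.log n) atTop (𝓝 a))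
    (hσ : Tendsto (fun n : ℕ => σ n ^ 2 - Real.log n) atTop (𝓝 b)) (hσ0 : ∀ n, 0 ≤ σ n) (t : ℝ) :
    Tendsto (fun n => charFun ((uniform n).map fun m => (X n m - μ n) / σ n) t) atTop
      (𝓝 (Complex.exp ((-(t ^ 2 / 2) : ℝ) : ℂ))) := by
  have hL := tendsto_log_natCast
  have hσ2 : Tendsto (fun n => σ n ^ 2) atTop atTop := by
    have := hσ.add_atTop hL
    simpa using this
  have hσt : Tendsto σ atTop atTop := by
    have := Real.tendsto_sqrt_atTop.comp hσ2
    exact this.congr fun n => Real.sqrt_sq (hσ0 n)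
  have hratio : Tendsto (fun n : ℕ => Real.log n / σ n ^ 2) atTop (𝓝 1) := by
    have h1 : Tendsto (fun n : ℕ => (σ n ^ 2 - Real.log n) / σ n ^ 2) atTop (𝓝 0) :=
      hσ.div_atTop hσ2
    have h2 := (tendsto_const_nhds (x := (1 : ℝ))).sub h1
    rw [sub_zero] at h2
    refine h2.congr' ?_
    filter_upwards [hσ2.eventually_gt_atTop 0] with n hn
    rw [sub_div, div_self hn.ne', sub_sub_cancel]
  set z : ℕ → ℂ := fun n => t / σ n * Complex.I with hz
  have hzn : ∀ n, ‖z n‖ = |t| / σ n := fun n => by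
    rw [hz]
    simp [abs_of_nonneg (hσ0 n)]
  have hzn0 : Tendsto (fun n => ‖z n‖) atTop (𝓝 0) := by
    simp only [hzn]
    exact tendsto_const_nhds.div_atTop hσt
  have hz0 : Tendsto z atTop (𝓝 0) := tendsto_zero_iff_norm_tendsto_zero.2 hzn0
  have hexpz : Tendsto (fun n => Complex.exp (z n)) atTop (𝓝 1) := by
    simpa [Function.comp_def] using (Complex.continuous_exp.tendsto 0).comp hz0
  -- The index and the argument move together, so locally uniform convergence is needed; the limit
  -- function equals 1 at v = 1.
  have hpgf : Tendsto (fun n => normalizedPgf n (Complex.exp (z n))) atTop (𝓝 1) := by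
    have h1 : (1 : ℂ) ∈ {v : ℂ | 0 < v.re} := by simp
    have h := tendstoLocallyUniformlyOn_normalizedPgf.tendsto_comp
      (HalfEdgeMap.continuousOn_leading (fun v hv => ne_neg_natCast_of_re_pos hv) 1 h1) h1
      (g := fun n => Complex.exp (z n)) (by rwa [isOpen_re_pos.nhdsWithin_eq h1])
    simpa using h
  have hquad : Tendsto (fun n : ℕ => (Real.log n : ℂ) * z n ^ 2 / 2) atTop
      (𝓝 ((-(t ^ 2 / 2) : ℝ) : ℂ)) := by
    have h1 := ((hratio.mul_const (-(t ^ 2 / 2))).ofReal)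
    rw [one_mul] at h1
    push_cast at h1 ⊢
    refine h1.congr fun n => ?_
    rw [hz]
    simp only [mul_pow, div_pow, Complex.I_sq]
    ring
  have hlin : Tendsto (fun n : ℕ => z n * ((μ n - Real.log n : ℝ) : ℂ)) atTop (𝓝 0) := by
    simpa using hz0.mul (hμ.ofReal)
  have hrem : Tendsto (fun n : ℕ => (Real.log n : ℂ) *
      (Complex.exp (z n) - 1 - z n - z n ^ 2 / 2)) atTop (𝓝 0) := by
    have hb : Tendsto (fun n : ℕ => t ^ 2 * (Real.log n / σ n ^ 2) * ‖z n‖ * Real.exp ‖z n‖) atTop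
        (𝓝 0) := by
      have := (((hratio.const_mul (t ^ 2)).mul hzn0).mul
        ((Real.continuous_exp.tendsto 0).comp hzn0))
      simpa using this
    refine squeeze_zero_norm (fun n => ?_) hb
    have h3 := Complex.norm_exp_sub_sum_le_norm_mul_exp (z n) 3
    simp only [Finset.sum_range_succ, Finset.sum_range_zero, zero_add, pow_zero,
      Nat.factorial_zero, Nat.cast_one, div_one, pow_one, Nat.factorial_one, ← sub_sub,
      Nat.factorial_two, Nat.cast_ofNat] at h3
    have hlog : 0 ≤ Real.log n := Real.log_natCast_nonneg n
    rw [norm_mul, Complex.norm_real, Real.norm_of_nonneg hlog]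
    calc _ ≤ Real.log n * (‖z n‖ ^ 3 * Real.exp ‖z n‖) := by gcongr
      _ = Real.log n * ‖z n‖ ^ 2 * ‖z n‖ * Real.exp ‖z n‖ := by ring
      _ = _ := by
        congr 2
        rw [hzn, div_pow, sq_abs]
        ring
  have hexp := (Complex.continuous_exp.tendsto _).comp ((hrem.add hquad).sub hlin)
  have hall := hexp.mul hpgf
  rw [zero_add, sub_zero, mul_one] at hall
  refine hall.congr fun n => ?_
  rw [charFun_standardized, normalizedPgf]
  simp only [Function.comp_apply]
  rw [mul_left_comm, ← Complex.exp_add, mul_comm]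
  congr 2
  rw [hz]
  push_cast
  ring

end RootedMap

theorem mainTheorem2 :
    -- central limit theorem
    TendstoInDistribution
        (fun (n : ℕ) (m : RootedMap n) =>
          (RootedMap.X n m - ∫ m', RootedMap.X n m' ∂(RootedMap.uniform n)) /
            Real.sqrt (variance (RootedMap.X n) (RootedMap.uniform n)))
        atTop (id : ℝ → ℝ) (fun n => RootedMap.uniform n) (gaussianReal 0 1) ∧
    -- logarithmic mean
    (fun n : ℕ => ∫ m, RootedMap.X n m ∂(RootedMap.uniform n)) ~[atTop]
        (fun n : ℕ => Real.log n) ∧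
    -- logarithmic variance
    (fun n : ℕ => variance (RootedMap.X n) (RootedMap.uniform n)) ~[atTop]
        (fun n : ℕ => Real.log n) ∧
    -- probability generating function, locally uniformly in `v` away from the poles of `Γ`
    (∀ K : Set ℂ, IsCompact K → (∀ v ∈ K, ∀ k : ℕ, v ≠ -(k : ℂ)) →
      ∃ C : ℝ, ∀ n : ℕ, 1 ≤ n → ∀ v ∈ K,
        ‖(∫ m, v ^ m.numVertices ∂(RootedMap.uniform n)) -
            2 ^ (v - 1) / Complex.Gamma v * (n : ℂ) ^ (v - 1)‖ ≤
          C / n * ‖2 ^ (v - 1) / Complex.Gamma v * (n : ℂ) ^ (v - 1)‖) := by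
  obtain ⟨a, ha⟩ := RootedMap.exists_tendsto_mean_sub_log
  obtain ⟨b, hb⟩ := RootedMap.exists_tendsto_variance_sub_log
  refine ⟨⟨fun n => by fun_prop, by fun_prop, ?_⟩, RootedMap.isEquivalent_log_of_tendsto_sub ha,
    RootedMap.isEquivalent_log_of_tendsto_sub hb,
    fun K hKc hK => RootedMap.exists_norm_pgf_sub_le hKc hK⟩
  -- Lévy's continuity theorem.
  refine ProbabilityMeasure.tendsto_iff_tendsto_charFun.2 fun t => ?_
  have hb' : Tendsto (fun n : ℕ => Real.sqrt (variance (RootedMap.X n) (RootedMap.uniform n)) ^ 2 -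
      Real.log n) atTop (𝓝 b) := hb.congr fun n => by rw [Real.sq_sqrt (variance_nonneg _ _)]
  have h := RootedMap.tendsto_charFun_standardized ha hb' (fun n => Real.sqrt_nonneg _) t
  simp only [ProbabilityMeasure.coe_mk, Measure.map_id, charFun_gaussianReal]
  convert h using 3
  simp
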